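/- Let $G$ be a reductive group over $\mathbb{C}$, that is, a linear algebraic group (a Zariski closed subgroup of some $GL_n(\mathbb{C})$) all of whose finite-dimensional regular representations are completely reducible. Let $V = V_0 \boxplus V_1$ be a finite-dimensional complex super vector space on which $G$ acts by regular representations on $V_0$ and on $V_1$. Let $P(V) = S(V_0)\otimes\bigwedge(V_1)$ be its supersymmetric algebra, with the induced action of $G$. Let $\mathbb{PD}(V)\subseteq \mathrm{End}_{\mathbb{C}}(P(V))$ be the algebra of polynomial coefficient differential operators, generated by the (left) multiplications by vectors of $V_0$ and $V_1$, the partial derivatives $\partial_\xi$, $\xi\in V_0^*$ (the derivation of $S(V_0)$ extending $\xi$), and the contractions by $\eta \in V_1^*$ (the antiderivation of $\bigwedge(V_1)$ extending $\eta$). Let $\mathbb{PD}(V)^G$ be the subalgebra of those operators in $\mathbb{PD}(V)$ that commute with the action of $G$ on $P(V)$. Then there are an index set $\Xi$, a family $(V(\lambda))_{\lambda\in\Xi}$ of pairwise non-isomorphic irreducible finite-dimensional regular representations of $G$, and a family $(V^\lambda)_{\lambda\in\Xi}$ of pairwise non-isomorphic irreducible $\mathbb{PD}(V)^G$-modules,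 such that, as a joint $\mathbb{C}[G]\otimes\mathbb{PD}(V)^G$-module (where $\mathbb{C}[G]$ is the group algebra), $$P(V)\;\cong\;\bigoplus_{\lambda\in\Xi} V(\lambda)\otimes V^\lambda .$$ -/

import Mathlib

open scoped TensorProduct DirectSum

universe u v w

noncomputable section

namespace SuperDuality

/-! ### Linear algebraic groups and their regular representations -/

section Groups

variable {n : ℕ}

/-- A subgroup of `GL_n(ℂ)` is Zariski closed (a linear algebraic group) if it is cut out inside
`GL_n(ℂ)` by a set of polynomials in the matrix entries. -/
def IsZariskiClosed (G : Subgroup (GL (Fin n) ℂ)) : Prop :=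
  ∃ S : Set (MvPolynomial (Fin n × Fin n) ℂ),
    ∀ g : GL (Fin n) ℂ, g ∈ G ↔
      ∀ p ∈ S, MvPolynomial.eval (fun ij : Fin n × Fin n => (g : Matrix (Fin n) (Fin n) ℂ) ij.1 ij.2) p = 0

/-- The algebra of regular functions on `G`: the functions on `G` that are polynomials in the
matrix entries and the inverse of the determinant. -/
def regularFunctions (G : Subgroup (GL (Fin n) ℂ)) : Subalgebra ℂ (G → ℂ) :=
  Algebra.adjoin ℂ
    (Set.range (fun (ij : Fin n × Fin n) (g : G) =>
        ((g : GL (Fin n) ℂ) : Matrix (Fin n) (Fin n) ℂ) ij.1 ij.2) ∪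
      {fun g : G => (((g : GL (Fin n) ℂ) : Matrix (Fin n) (Fin n) ℂ).det)⁻¹})

/-- A representation of `G` is regular if all its matrix coefficients are regular functions.
(It is applied to finite-dimensional representations only.) -/
def IsRegularRep (G : Subgroup (GL (Fin n) ℂ)) {W : Type w} [AddCommGroup W] [Module ℂ W]
    (σ : Representation ℂ G W) : Prop :=
  ∀ (φ : Module.Dual ℂ W) (x : W), (fun g : G => φ (σ g x)) ∈ regularFunctions G

/-- A reductive group: a linear algebraic group over `ℂ` all of whose finite-dimensional regular
representations are completely reducible (every invariant subspace has an invariant complement). -/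
structure IsReductiveGroup (G : Subgroup (GL (Fin n) ℂ)) : Prop where
  isZariskiClosed : IsZariskiClosed G
  completelyReducible : ∀ (W : Type) [AddCommGroup W] [Module ℂ W] [FiniteDimensional ℂ W]
    (σ : Representation ℂ G W), IsRegularRep G σ → σ.IsSemisimpleRepresentation

end Groups

/-! ### The supersymmetric algebra -/

section Algebra

/-- The algebra endomorphism of `S(U)` induced by a linear endomorphism of `U`. -/
def symMap {U : Type u} [AddCommGroup U] [Module ℂ U] (f : U →ₗ[ℂ] U) :
    SymmetricAlgebra ℂ U →ₐ[ℂ] SymmetricAlgebra ℂ U :=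
  SymmetricAlgebra.lift (SymmetricAlgebra.ι ℂ U ∘ₗ f)

/-- The supersymmetric algebra `P(V) = S(V₀) ⊗ Λ(V₁)` of the super vector space `V = V₀ ⊞ V₁`
(as a vector space). -/
def P (V₀ : Type u) (V₁ : Type v) [AddCommGroup V₀] [Module ℂ V₀] [AddCommGroup V₁]
    [Module ℂ V₁] : Type (max u v) :=
  SymmetricAlgebra ℂ V₀ ⊗[ℂ] ExteriorAlgebra ℂ V₁

variable {V₀ : Type u} {V₁ : Type v} [AddCommGroup V₀] [Module ℂ V₀] [AddCommGroup V₁]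
  [Module ℂ V₁]

instance instAddCommGroupP : AddCommGroup (P V₀ V₁) :=
  inferInstanceAs (AddCommGroup (SymmetricAlgebra ℂ V₀ ⊗[ℂ] ExteriorAlgebra ℂ V₁))

instance instModuleP : Module ℂ (P V₀ V₁) :=
  inferInstanceAs (Module ℂ (SymmetricAlgebra ℂ V₀ ⊗[ℂ] ExteriorAlgebra ℂ V₁))

variable (V₀ V₁) in
/-- The identity map from `S(V₀) ⊗ Λ(V₁)` to `P(V)`. -/
def toP : (SymmetricAlgebra ℂ V₀ ⊗[ℂ] ExteriorAlgebra ℂ V₁) ≃ₗ[ℂ] P V₀ V₁ :=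
  LinearEquiv.refl ℂ (SymmetricAlgebra ℂ V₀ ⊗[ℂ] ExteriorAlgebra ℂ V₁)

/-- The endomorphism `f ⊗ h` of `P(V) = S(V₀) ⊗ Λ(V₁)`. -/
def mapP (f : SymmetricAlgebra ℂ V₀ →ₗ[ℂ] SymmetricAlgebra ℂ V₀)
    (h : ExteriorAlgebra ℂ V₁ →ₗ[ℂ] ExteriorAlgebra ℂ V₁) : Module.End ℂ (P V₀ V₁) :=
  (toP V₀ V₁).conj (TensorProduct.map f h)

theorem mapP_id : mapP (V₀ := V₀) (V₁ := V₁) LinearMap.id LinearMap.id = 1 := by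
  rw [mapP, TensorProduct.map_id, LinearEquiv.conj_id, Module.End.one_eq_id]

theorem mapP_comp (f f' : SymmetricAlgebra ℂ V₀ →ₗ[ℂ] SymmetricAlgebra ℂ V₀)
    (h h' : ExteriorAlgebra ℂ V₁ →ₗ[ℂ] ExteriorAlgebra ℂ V₁) :
    mapP (f ∘ₗ f') (h ∘ₗ h') = mapP f h * mapP f' h' := by
  rw [mapP, TensorProduct.map_comp, LinearEquiv.conj_comp, Module.End.mul_eq_comp, mapP, mapP]

theorem symMap_one {U : Type u} [AddCommGroup U] [Module ℂ U] :
    symMap (1 : U →ₗ[ℂ] U) = AlgHom.id ℂ (SymmetricAlgebra ℂ U) := by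
  apply SymmetricAlgebra.algHom_ext
  ext x
  simp [symMap]

theorem symMap_mul {U : Type u} [AddCommGroup U] [Module ℂ U] (f g : U →ₗ[ℂ] U) :
    symMap (f * g) = (symMap f).comp (symMap g) := by
  apply SymmetricAlgebra.algHom_ext
  ext x
  simp [symMap]

/-- The representation of `G` on `P(V)` induced by representations on `V₀` and `V₁`:
`g` acts by `S(ρ₀ g) ⊗ Λ(ρ₁ g)`. -/
def repP {G : Type w} [Group G] (ρ₀ : Representation ℂ G V₀) (ρ₁ : Representation ℂ G V₁) :
    Representation ℂ G (P V₀ V₁) where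
  toFun g := mapP (symMap (ρ₀ g)).toLinearMap (ExteriorAlgebra.map (ρ₁ g)).toLinearMap
  map_one' := by
    rw [map_one ρ₀, map_one ρ₁, symMap_one, Module.End.one_eq_id, ExteriorAlgebra.map_id,
      AlgHom.toLinearMap_id, AlgHom.toLinearMap_id, mapP_id]
  map_mul' g g' := by
    rw [map_mul ρ₀, map_mul ρ₁, symMap_mul, Module.End.mul_eq_comp (ρ₁ g),
      ← ExteriorAlgebra.map_comp_map, AlgHom.comp_toLinearMap, AlgHom.comp_toLinearMap,
      mapP_comp]

/-! ### Polynomial coefficient differential operators -/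

/-- The algebra homomorphism `S(U) → S(U) ⊕ ε S(U)`, `ε ^ 2 = 0`, with `x ↦ x + ε ξ(x)` for
`x ∈ U`. -/
def symDerivAux {U : Type u} [AddCommGroup U] [Module ℂ U] (ξ : Module.Dual ℂ U) :
    SymmetricAlgebra ℂ U →ₐ[ℂ]
      TrivSqZeroExt (SymmetricAlgebra ℂ U) (SymmetricAlgebra ℂ U) :=
  SymmetricAlgebra.lift
    { toFun := fun x => TrivSqZeroExt.inl (SymmetricAlgebra.ι ℂ U x) +
        TrivSqZeroExt.inr (algebraMap ℂ (SymmetricAlgebra ℂ U) (ξ x))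
      map_add' := fun x y => by
        ext <;> simp [Algebra.algebraMap_eq_smul_one, add_smul]
      map_smul' := fun c x => by
        ext <;> simp [Algebra.algebraMap_eq_smul_one, mul_smul] }

theorem fst_symDerivAux {U : Type u} [AddCommGroup U] [Module ℂ U] (ξ : Module.Dual ℂ U)
    (a : SymmetricAlgebra ℂ U) : (symDerivAux ξ a).fst = a := by
  have h : (TrivSqZeroExt.fstHom ℂ (SymmetricAlgebra ℂ U) (SymmetricAlgebra ℂ U)).comp
      (symDerivAux ξ) = AlgHom.id ℂ (SymmetricAlgebra ℂ U) := by
    apply SymmetricAlgebra.algHom_ext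
    ext x
    simp [symDerivAux]
  exact DFunLike.congr_fun h a

/-- The partial derivative `∂_ξ` of `S(U)` in the direction of `ξ ∈ U^*`: the derivation with
`∂_ξ(x) = ξ(x)` for `x ∈ U`. -/
def symDeriv {U : Type u} [AddCommGroup U] [Module ℂ U] (ξ : Module.Dual ℂ U) :
    Derivation ℂ (SymmetricAlgebra ℂ U) (SymmetricAlgebra ℂ U) where
  toFun a := (symDerivAux ξ a).snd
  map_add' a b := by simp
  map_smul' c a := by simp
  map_one_eq_zero' := by simp
  leibniz' a b := by
    simp [fst_symDerivAux, mul_comm b]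

theorem symDeriv_ι {U : Type u} [AddCommGroup U] [Module ℂ U] (ξ : Module.Dual ℂ U) (x : U) :
    symDeriv ξ (SymmetricAlgebra.ι ℂ U x) = algebraMap ℂ (SymmetricAlgebra ℂ U) (ξ x) := by
  simp [symDeriv, symDerivAux, Algebra.algebraMap_eq_smul_one]

/-- Multiplication by an even vector `x ∈ V₀` on `P(V)`. -/
def mulEven (x : V₀) : Module.End ℂ (P V₀ V₁) :=
  mapP (LinearMap.mulLeft ℂ (SymmetricAlgebra.ι ℂ V₀ x)) LinearMap.id

/-- (Left) multiplication by an odd vector `y ∈ V₁` on `P(V)`. -/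
def mulOdd (y : V₁) : Module.End ℂ (P V₀ V₁) :=
  mapP LinearMap.id (LinearMap.mulLeft ℂ (ExteriorAlgebra.ι ℂ y))

/-- The even partial derivative on `P(V)` attached to `ξ ∈ V₀^*`. -/
def derivEven (ξ : Module.Dual ℂ V₀) : Module.End ℂ (P V₀ V₁) :=
  mapP (symDeriv ξ).toLinearMap LinearMap.id

/-- The odd partial derivative on `P(V)` attached to `η ∈ V₁^*`: contraction by `η`, i.e. the
antiderivation of `Λ(V₁)` with `y ↦ η(y)` for `y ∈ V₁`. -/
def derivOdd (η : Module.Dual ℂ V₁) : Module.End ℂ (P V₀ V₁) :=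
  mapP LinearMap.id
    (CliffordAlgebra.contractLeft (Q := (0 : QuadraticForm ℂ V₁)) η :
      ExteriorAlgebra ℂ V₁ →ₗ[ℂ] ExteriorAlgebra ℂ V₁)

variable (V₀ V₁) in
/-- The algebra `PD(V)` of polynomial coefficient differential operators on the super vector space
`V = V₀ ⊞ V₁` (the Weyl-Clifford algebra), as an algebra of endomorphisms of `P(V)`: it is generated
by the multiplications by vectors of `V` and the partial derivatives attached to vectors of
`V^*`. -/
def PD : Subalgebra ℂ (Module.End ℂ (P V₀ V₁)) :=
  Algebra.adjoin ℂ
    (Set.range mulEven ∪ Set.range mulOdd ∪ Set.range derivEven ∪ Set.range derivOdd)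

/-- The algebra `PD(V)^G` of `G`-invariant differential operators: those `T ∈ PD(V)` fixed under
conjugation by `G`, i.e. commuting with the action of every `g ∈ G` on `P(V)`. -/
def PDInv {G : Type w} [Group G] (ρ₀ : Representation ℂ G V₀) (ρ₁ : Representation ℂ G V₁) :
    Subalgebra ℂ (Module.End ℂ (P V₀ V₁)) :=
  PD V₀ V₁ ⊓ Subalgebra.centralizer ℂ (Set.range (repP ρ₀ ρ₁))

end Algebra

end SuperDuality

end

/-! The orbit maps of `G` on `P(V)` are regular, so `P(V)` is a sum of finite-dimensional regular
representations and, `G` being reductive, is semisimple with finite-dimensional simple constituents.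
For each simple type `S` occurring in it, the evaluation map `S ⊗ Hom_G(S, P(V)) → P(V)` is an
isomorphism onto the isotypic component of `S`, and `PD(V)^G` acts on the multiplicity space
`Hom_G(S, P(V))` by postcomposition. Summing over the types gives `decomposition`, which respects
both actions.

What remains is that the multiplicity spaces are irreducible and pairwise non-isomorphic. Both facts
follow from a density statement, `isDense_PDInv`: every `G`-map from a finite-dimensional invariant
subspace `X` to `P(V)` is the restriction of an invariant differential operator (see
`IsDense.isSimpleModule_hom` and `IsDense.isEmpty_linearEquiv_hom`).

Density is proved in two moves. Differentiating any nonzero element down to a constant and then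
multiplying back up shows that `P(V)` is irreducible over `PD(V)`, and its only endomorphisms are
scalars (`exists_eq_smul_of_commute`). The Jacobson density theorem then realises any linear map on
`X` by some `r ∈ PD(V)` (`exists_mem_PD_apply_eq`). If the map is equivariant, `r` is invariant
modulo the operators vanishing on `X`. Since `PD(V)` is locally regular under conjugation, complete
reducibility replaces `r` by a truly invariant operator with the same restriction to `X`
(`exists_invariant_sub_mem`). -/

namespace MultiplicitySpace

variable {k A H M : Type*} [Field k] [Ring A] [Algebra k A] [Ring H]
  [AddCommGroup M] [Module k M] [Module A M] [IsScalarTower k A M] [Module H M]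
  [SMulCommClass A H M]

/-! ### Evaluation maps and Burnside's theorem. -/

section Evaluation

variable {S : Type*} [AddCommGroup S] [Module k S] [Module A S] [IsScalarTower k A S]

variable (k A S M) in
/-- The evaluation map `S ⊗ Hom_A(S, M) → M`. -/
noncomputable def eval : S ⊗[k] (S →ₗ[A] M) →ₗ[k] M :=
  TensorProduct.lift
    (LinearMap.flip (LinearMap.restrictScalarsₗ k A S M k))

@[simp]
theorem eval_tmul (x : S) (f : S →ₗ[A] M) : eval k A M S (x ⊗ₜ f) = f x := rfl

/-- A finite-dimensional simple module over an algebra over an algebraically closed field: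
every linear endomorphism is given by the action of an element of the algebra (Burnside). -/
theorem exists_smul_eq_of_isSimpleModule [IsAlgClosed k] [IsSimpleModule A S]
    [FiniteDimensional k S] (φ : S →ₗ[k] S) : ∃ a : A, ∀ x, a • x = φ x := by
  classical
  let b := Module.finBasis k S
  let F : Module.End (Module.End A S) S :=
    { toFun := φ
      map_add' := map_add φ
      -- By Schur's lemma the `A`-endomorphisms of `S` are scalars, so a `k`-linear `φ` commutes
      -- with all of them, as the density theorem requires.
      map_smul' := fun e x => by
        obtain ⟨c, rfl⟩ :=
          (IsSimpleModule.algebraMap_end_bijective_of_isAlgClosed (A := A) (V := S) k).2 e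
        simp }
  obtain ⟨a, ha⟩ := jacobson_density (R := A) F (Finset.univ.image b)
  refine ⟨a, fun x => ?_⟩
  have h : Algebra.lsmul k k S a = φ :=
    b.ext fun i => (ha (b i) (Finset.mem_image_of_mem _ (Finset.mem_univ i))).symm
  exact LinearMap.congr_fun h x

/-- Write a tensor as `∑ bᵢ ⊗ fᵢ` with `bᵢ` a basis of `S`. By Burnside some `a` acts as the
rank-one operator sending `bⱼ` to `y` and the other basis vectors to `0`; applying it to `∑ fᵢ(bᵢ) =
0` leaves `fⱼ(y) = 0`. -/
theorem eval_injective [IsAlgClosed k] [IsSimpleModule A S] [FiniteDimensional k S] :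
    Function.Injective (eval k A M S) := by
  classical
  let b := Module.finBasis k S
  rw [injective_iff_map_eq_zero]
  intro t ht
  obtain ⟨f, rfl⟩ := (TensorProduct.equivFinsuppOfBasisLeft b (N := S →ₗ[A] M)).symm.surjective t
  rw [TensorProduct.equivFinsuppOfBasisLeft_symm_apply,
    Finsupp.sum_fintype _ _ (by simp)] at ht
  simp only [map_sum, eval_tmul] at ht
  suffices f = 0 by rw [this, map_zero]
  ext j y
  obtain ⟨a, ha⟩ := exists_smul_eq_of_isSimpleModule (A := A)
    ((LinearMap.toSpanSingleton k S y).comp (b.coord j))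
  have h := congrArg (a • ·) ht
  simp only [Finset.smul_sum, smul_zero, ← map_smul, ha] at h
  simpa [Finsupp.single_apply, ite_smul, apply_ite] using h

end Evaluation

/-! ### Isotypic decomposition with multiplicity spaces. -/

section Components

variable (A M) in
/-- A simple submodule representing an isotypic component. -/
noncomputable def simpleType (c : isotypicComponents A M) : Submodule A M := c.2.choose

instance (c : isotypicComponents A M) : IsSimpleModule A (simpleType A M c) :=
  c.2.choose_spec.1

theorem coe_eq_isotypicComponent (c : isotypicComponents A M) :
    (c : Submodule A M) = isotypicComponent A M (simpleType A M c) :=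
  c.2.choose_spec.2

/-- A map out of a simple module is zero or injective, and in the latter case its range is one of
the copies whose sum is the component. -/
theorem apply_mem_component (c : isotypicComponents A M) (f : simpleType A M c →ₗ[A] M)
    (x : simpleType A M c) : f x ∈ (c : Submodule A M) := by
  rw [coe_eq_isotypicComponent]
  rcases f.injective_or_eq_zero with hf | rfl
  · have h : LinearMap.range f ∈
        {m : Submodule A M | Nonempty (m ≃ₗ[A] simpleType A M c)} :=
      ⟨(LinearEquiv.ofInjective f hf).symm⟩
    exact le_sSup h (LinearMap.mem_range_self f x)
  · simp

theorem eq_of_linearEquiv {c d : isotypicComponents A M}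
    (e : simpleType A M c ≃ₗ[A] simpleType A M d) : c = d := by
  ext1
  rw [coe_eq_isotypicComponent, coe_eq_isotypicComponent, e.isotypicComponent_eq]

theorem exists_linearEquiv_simpleType (N : Submodule A M) [IsSimpleModule A N] :
    ∃ c : isotypicComponents A M, Nonempty (simpleType A M c ≃ₗ[A] N) := by
  let c : isotypicComponents A M := ⟨isotypicComponent A M N, N, inferInstance, rfl⟩
  refine ⟨c, ?_⟩
  have hle : simpleType A M c ≤ isotypicComponent A M N :=
    (Submodule.le_isotypicComponent _).trans (coe_eq_isotypicComponent c).ge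
  exact isIsotypicOfType_submodule_iff.mp (IsIsotypicOfType.isotypicComponent A M N) _ hle

theorem iSupIndep_components :
    iSupIndep fun c : isotypicComponents A M => (c : Submodule A M) :=
  (sSupIndep_iff _).1 (sSupIndep_isotypicComponents A M)

theorem disjoint_components {c d : isotypicComponents A M} (h : c ≠ d) :
    Disjoint (c : Submodule A M) d :=
  iSupIndep_components.pairwiseDisjoint h

variable (k A M) in
/-- The sum of the evaluation maps `V(λ) ⊗ Hom_A(V(λ), M) → M`. -/
noncomputable def totalEval :
    (⨁ c : isotypicComponents A M, simpleType A M c ⊗[k] (simpleType A M c →ₗ[A] M)) →ₗ[k] M :=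
  by
    classical
    exact DirectSum.toModule k _ M fun c => eval k A M (simpleType A M c)

@[simp]
theorem totalEval_lof [DecidableEq (isotypicComponents A M)] (c : isotypicComponents A M)
    (t : simpleType A M c ⊗[k] (simpleType A M c →ₗ[A] M)) :
    totalEval k A M (DirectSum.lof k _ (fun c : isotypicComponents A M =>
      simpleType A M c ⊗[k] (simpleType A M c →ₗ[A] M)) c t) = eval k A M _ t := by
  rw [totalEval]
  convert DirectSum.toModule_lof k (φ := fun c => eval k A M (simpleType A M c)) c t

theorem eval_mem_component (c : isotypicComponents A M)
    (t : simpleType A M c ⊗[k] (simpleType A M c →ₗ[A] M)) :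
    eval k A M _ t ∈ (c : Submodule A M) := by
  induction t with
  | zero => simp
  | tmul x f => exact apply_mem_component c f x
  | add s t hs ht => rw [map_add]; exact add_mem hs ht

/-- Each evaluation map is injective with values in its own isotypic component, and the components
are independent. So the total map is an injective componentwise map followed by the injective sum
map. -/
theorem totalEval_injective [IsAlgClosed k]
    (hfin : ∀ c : isotypicComponents A M, FiniteDimensional k (simpleType A M c)) :
    Function.Injective (totalEval k A M) := by
  classical
  let F : ∀ c : isotypicComponents A M,
      simpleType A M c ⊗[k] (simpleType A M c →ₗ[A] M) →ₗ[k] (c : Submodule A M) :=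
    fun c => (eval k A M (simpleType A M c)).codRestrict
      ((c : Submodule A M).restrictScalars k) (eval_mem_component c)
  have hF : ∀ c, Function.Injective (F c) := fun c x y h =>
    eval_injective (congrArg Subtype.val h)
  have h2 := (iSupIndep_components (A := A) (M := M)).dfinsupp_lsum_injective
  have h3 : Function.Injective (DFinsupp.mapRange (fun c => F c) fun c => map_zero _) :=
    (DFinsupp.mapRange_injective _ _).2 hF
  suffices h : ∀ t, totalEval k A M t = DFinsupp.lsum ℕ
      (fun c : isotypicComponents A M => (c : Submodule A M).subtype)
      (DFinsupp.mapRange (fun c => F c) (fun c => map_zero _) t) from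
    fun x y hxy => h3 (h2 (by rwa [h, h] at hxy))
  intro t
  induction t using DirectSum.induction_on with
  | zero => simp
  | of c x =>
    rw [← DirectSum.lof_eq_of k, totalEval_lof, DirectSum.lof_eq_of]
    erw [DFinsupp.mapRange_single]
    simp only [DFinsupp.lsum_single, Submodule.subtype_apply]
    rfl
  | add x y hx hy =>
    rw [map_add, hx, hy, ← map_add]
    congr 1
    ext c : 1
    simp [DirectSum.add_apply]

theorem totalEval_surjective [IsSemisimpleModule A M] :
    Function.Surjective (totalEval k A M) := by
  classical
  intro p
  have hp : p ∈ sSup {N : Submodule A M | IsSimpleModule A N} := by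
    rw [IsSemisimpleModule.sSup_simples_eq_top]; trivial
  rw [sSup_eq_iSup'] at hp
  induction hp using Submodule.iSup_induction' with
  | zero => exact ⟨0, map_zero _⟩
  | add x y _ _ hx hy =>
    obtain ⟨s, rfl⟩ := hx
    obtain ⟨t, rfl⟩ := hy
    exact ⟨s + t, map_add _ _ _⟩
  | mem N x hx =>
    have : IsSimpleModule A (N : Submodule A M) := N.2
    obtain ⟨c, ⟨e⟩⟩ := exists_linearEquiv_simpleType (N : Submodule A M)
    -- With `e` identifying the simple type with `N`, the vector `x` is the value at `e⁻¹ x` of the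
    -- embedding onto `N`.
    refine ⟨DirectSum.lof k _ _ c (e.symm ⟨x, hx⟩ ⊗ₜ ((N : Submodule A M).subtype ∘ₗ e.toLinearMap)), ?_⟩
    rw [totalEval_lof]
    simp

variable (k A M) in
/-- A semisimple module with finite-dimensional simple constituents is the direct sum of the
tensor products of its simple types with their multiplicity spaces. -/
noncomputable def decomposition [IsAlgClosed k] [IsSemisimpleModule A M]
    (hfin : ∀ c : isotypicComponents A M, FiniteDimensional k (simpleType A M c)) :
    M ≃ₗ[k] ⨁ c : isotypicComponents A M,
      simpleType A M c ⊗[k] (simpleType A M c →ₗ[A] M) :=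
  (LinearEquiv.ofBijective (totalEval k A M)
    ⟨totalEval_injective hfin, totalEval_surjective⟩).symm

theorem decomposition_smul_smul [Algebra k H] [IsScalarTower k H M] [IsAlgClosed k] [IsSemisimpleModule A M]
    (hfin : ∀ c : isotypicComponents A M, FiniteDimensional k (simpleType A M c))
    (a : A) (h : H) (p : M) :
    decomposition k A M hfin (a • h • p) =
      DirectSum.lmap (fun c => TensorProduct.map (Algebra.lsmul k k (simpleType A M c) a)
        (Algebra.lsmul k k (simpleType A M c →ₗ[A] M) h)) (decomposition k A M hfin p) := by
  classical
  obtain ⟨t, rfl⟩ := (decomposition k A M hfin).symm.surjective p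
  rw [LinearEquiv.apply_symm_apply, ← LinearEquiv.eq_symm_apply]
  change a • h • totalEval k A M t = totalEval k A M _
  induction t using DirectSum.induction_on with
  | zero => simp
  | add x y hx hy => rw [map_add, smul_add, smul_add, hx, hy, map_add, map_add]
  | of c x =>
    rw [← DirectSum.lof_eq_of k, DirectSum.lmap_lof, totalEval_lof, totalEval_lof]
    induction x with
    | zero => simp
    | add x y hx hy => rw [map_add, smul_add, smul_add, hx, hy, map_add, map_add]
    | tmul x f => simp

end Components

/-! ### Consequences of density for the multiplicity spaces. -/

section Density

/-- Every `A`-linear map from a finite-dimensional `A`-submodule of `M` to `M` is given by the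
action of an element of `H`. -/
def IsDense (k A H M : Type*) [Field k] [Ring A] [Algebra k A] [Ring H] [AddCommGroup M]
    [Module k M] [Module A M] [IsScalarTower k A M] [Module H M] : Prop :=
  ∀ X : Submodule A M, FiniteDimensional k X → ∀ T : X →ₗ[A] M,
    ∃ h : H, ∀ x : X, h • (x : M) = T x

/-- A nonzero `f` is injective, so density applies to `g ∘ f⁻¹` on the range of `f`. -/
theorem IsDense.exists_smul_eq (hd : IsDense k A H M) (S : Submodule A M)
    [FiniteDimensional k S] [IsSimpleModule A S] {f : S →ₗ[A] M} (hf : f ≠ 0)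
    (g : S →ₗ[A] M) : ∃ h : H, h • f = g := by
  have hinj : Function.Injective f := f.injective_or_eq_zero.resolve_right hf
  let e := LinearEquiv.ofInjective f hinj
  have : FiniteDimensional k (LinearMap.range f) :=
    Module.Finite.equiv (e.restrictScalars k)
  obtain ⟨h, hh⟩ := hd (LinearMap.range f) this (g ∘ₗ e.symm.toLinearMap)
  refine ⟨h, LinearMap.ext fun x => ?_⟩
  have := hh (e x)
  simpa [e] using this

theorem IsDense.isSimpleModule_hom (hd : IsDense k A H M) (S : Submodule A M)
    [FiniteDimensional k S] [IsSimpleModule A S] : IsSimpleModule H (S →ₗ[A] M) := by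
  have : Nontrivial S := IsSimpleModule.nontrivial A S
  have : Nontrivial (S →ₗ[A] M) := by
    refine ⟨S.subtype, 0, fun h => ?_⟩
    obtain ⟨x, hx⟩ := exists_ne (0 : S)
    exact hx (Subtype.ext (LinearMap.congr_fun h x))
  rw [isSimpleModule_iff_toSpanSingleton_surjective]
  exact ⟨this, fun f hf g => hd.exists_smul_eq S hf g⟩

/-- Let `i` be the inclusion of the first simple type and `ψ` a supposed isomorphism. The ranges of
`i` and `ψ i` lie in different isotypic components, so density gives `h` that is the identity on the
first and zero on the second. Then `ψ i = ψ (h • i) = h • ψ i = 0`, which is absurd. -/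
theorem IsDense.isEmpty_linearEquiv_hom (hd : IsDense k A H M) {c d : isotypicComponents A M}
    [FiniteDimensional k (simpleType A M c)] [FiniteDimensional k (simpleType A M d)]
    (hcd : c ≠ d) :
    IsEmpty ((simpleType A M c →ₗ[A] M) ≃ₗ[H] (simpleType A M d →ₗ[A] M)) := by
  refine ⟨fun ψ => ?_⟩
  have : Nontrivial (simpleType A M c) := IsSimpleModule.nontrivial A _
  let i := (simpleType A M c).subtype
  have hi : i ≠ 0 := fun h => by
    obtain ⟨x, hx⟩ := exists_ne (0 : simpleType A M c)
    exact hx (Subtype.ext (LinearMap.congr_fun h x))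
  have hfcN : LinearMap.range i ≤ c := by
    rintro _ ⟨x, rfl⟩; exact apply_mem_component c i x
  have hfdN : LinearMap.range (ψ i) ≤ d := by
    rintro _ ⟨x, rfl⟩; exact apply_mem_component d (ψ i) x
  have hdisj := (disjoint_components hcd).mono hfcN hfdN
  let F := i.coprod (ψ i)
  have hψ : Function.Injective (ψ i) :=
    (ψ i).injective_or_eq_zero.resolve_right fun h => hi (by simpa using h)
  have hF : Function.Injective F := by
    rw [← LinearMap.ker_eq_bot, LinearMap.ker_coprod_of_disjoint_range _ _ hdisj,
      LinearMap.ker_eq_bot.2 hψ, Submodule.ker_subtype, Submodule.prod_bot]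
  let e := LinearEquiv.ofInjective F hF
  obtain ⟨h, hh⟩ := hd (LinearMap.range F) (Module.Finite.equiv (e.restrictScalars k))
    (i ∘ₗ LinearMap.fst A _ _ ∘ₗ e.symm.toLinearMap)
  have h1 : h • i = i := by
    ext x
    have := hh (e (x, 0))
    simpa [e, F] using this
  have h2 : h • ψ i = 0 := by
    ext x
    have := hh (e (0, x))
    simpa [e, F] using this
  rw [← map_smul, h1] at h2
  exact hi (by simpa using h2)

end Density

end MultiplicitySpace

namespace SuperDuality

/-! ### The Weyl–Clifford relations and the grading of `P(V)`. -/

section WeylClifford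

variable {V₀ : Type u} {V₁ : Type v} [AddCommGroup V₀] [Module ℂ V₀] [AddCommGroup V₁]
  [Module ℂ V₁]

@[simp]
theorem mapP_toP_tmul (f : SymmetricAlgebra ℂ V₀ →ₗ[ℂ] SymmetricAlgebra ℂ V₀)
    (h : ExteriorAlgebra ℂ V₁ →ₗ[ℂ] ExteriorAlgebra ℂ V₁) (s : SymmetricAlgebra ℂ V₀)
    (t : ExteriorAlgebra ℂ V₁) :
    mapP f h (toP V₀ V₁ (s ⊗ₜ t)) = toP V₀ V₁ (f s ⊗ₜ h t) := by
  simp [mapP, LinearEquiv.conj_apply]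

theorem toP_induction {motive : P V₀ V₁ → Prop} (zero : motive 0)
    (tmul : ∀ s t, motive (toP V₀ V₁ (s ⊗ₜ t)))
    (add : ∀ p q, motive p → motive q → motive (p + q)) (p : P V₀ V₁) : motive p := by
  obtain ⟨t, rfl⟩ := (toP V₀ V₁).surjective p
  induction t with
  | zero => simpa using zero
  | tmul s t => exact tmul s t
  | add x y hx hy => rw [map_add]; exact add _ _ hx hy

theorem end_ext {A B : Module.End ℂ (P V₀ V₁)}
    (h : ∀ s t, A (toP V₀ V₁ (s ⊗ₜ t)) = B (toP V₀ V₁ (s ⊗ₜ t))) : A = B := by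
  ext p
  induction p using toP_induction with
  | zero => simp
  | tmul s t => exact h s t
  | add p q hp hq => rw [map_add, map_add, hp, hq]

theorem mulEven_toP_tmul (x : V₀) (s : SymmetricAlgebra ℂ V₀) (t : ExteriorAlgebra ℂ V₁) :
    mulEven x (toP V₀ V₁ (s ⊗ₜ t)) = toP V₀ V₁ ((SymmetricAlgebra.ι ℂ V₀ x * s) ⊗ₜ t) := by
  simp [mulEven]

theorem mulOdd_toP_tmul (y : V₁) (s : SymmetricAlgebra ℂ V₀) (t : ExteriorAlgebra ℂ V₁) :
    mulOdd y (toP V₀ V₁ (s ⊗ₜ t)) = toP V₀ V₁ (s ⊗ₜ (ExteriorAlgebra.ι ℂ y * t)) := by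
  simp [mulOdd]

theorem derivEven_toP_tmul (ξ : Module.Dual ℂ V₀) (s : SymmetricAlgebra ℂ V₀)
    (t : ExteriorAlgebra ℂ V₁) :
    derivEven ξ (toP V₀ V₁ (s ⊗ₜ t)) = toP V₀ V₁ (symDeriv ξ s ⊗ₜ t) := by
  simp [derivEven]

theorem derivOdd_toP_tmul (η : Module.Dual ℂ V₁) (s : SymmetricAlgebra ℂ V₀)
    (t : ExteriorAlgebra ℂ V₁) :
    derivOdd η (toP V₀ V₁ (s ⊗ₜ t)) = toP V₀ V₁ (s ⊗ₜ
      CliffordAlgebra.contractLeft (Q := (0 : QuadraticForm ℂ V₁)) η t) := by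
  simp [derivOdd]

theorem contractLeft_ι_mul_exterior (η : Module.Dual ℂ V₁) (y : V₁)
    (t : ExteriorAlgebra ℂ V₁) :
    CliffordAlgebra.contractLeft (Q := (0 : QuadraticForm ℂ V₁)) η (ExteriorAlgebra.ι ℂ y * t) =
      η y • t - ExteriorAlgebra.ι ℂ y *
        CliffordAlgebra.contractLeft (Q := (0 : QuadraticForm ℂ V₁)) η t :=
  CliffordAlgebra.contractLeft_ι_mul η y t

theorem ι_mul_ι_swap (y z : V₁) :
    ExteriorAlgebra.ι ℂ y * ExteriorAlgebra.ι ℂ z =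
      -(ExteriorAlgebra.ι ℂ z * ExteriorAlgebra.ι ℂ y) :=
  eq_neg_of_add_eq_zero_left (ExteriorAlgebra.ι_add_mul_swap y z)

theorem derivEven_mul_mulEven (ξ : Module.Dual ℂ V₀) (x : V₀) :
    (derivEven ξ * mulEven x : Module.End ℂ (P V₀ V₁)) = mulEven x * derivEven ξ + ξ x • 1 := by
  refine end_ext fun s t => ?_
  simp only [Module.End.mul_apply, LinearMap.add_apply, LinearMap.smul_apply,
    Module.End.one_apply, mulEven_toP_tmul, derivEven_toP_tmul, Derivation.leibniz, symDeriv_ι,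
    TensorProduct.add_tmul, map_add, smul_eq_mul]
  rw [← map_smul, TensorProduct.smul_tmul', Algebra.smul_def, mul_comm s]

theorem derivEven_mul_mulOdd (ξ : Module.Dual ℂ V₀) (y : V₁) :
    (derivEven ξ * mulOdd y : Module.End ℂ (P V₀ V₁)) = mulOdd y * derivEven ξ := by
  refine end_ext fun s t => ?_
  simp [mulOdd_toP_tmul, derivEven_toP_tmul]

theorem derivOdd_mul_mulEven (η : Module.Dual ℂ V₁) (x : V₀) :
    (derivOdd η * mulEven x : Module.End ℂ (P V₀ V₁)) = mulEven x * derivOdd η := by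
  refine end_ext fun s t => ?_
  simp [mulEven_toP_tmul, derivOdd_toP_tmul]

theorem derivOdd_mul_mulOdd (η : Module.Dual ℂ V₁) (y : V₁) :
    (derivOdd η * mulOdd y : Module.End ℂ (P V₀ V₁)) = η y • 1 - mulOdd y * derivOdd η := by
  refine end_ext fun s t => ?_
  simp [mulOdd_toP_tmul, derivOdd_toP_tmul, contractLeft_ι_mul_exterior, TensorProduct.tmul_sub]

theorem mulEven_mul_mulEven (x y : V₀) :
    (mulEven x * mulEven y : Module.End ℂ (P V₀ V₁)) = mulEven y * mulEven x := by
  refine end_ext fun s t => ?_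
  simp [mulEven_toP_tmul, mul_left_comm]

theorem mulEven_mul_mulOdd (x : V₀) (y : V₁) :
    (mulEven x * mulOdd y : Module.End ℂ (P V₀ V₁)) = mulOdd y * mulEven x := by
  refine end_ext fun s t => ?_
  simp [mulEven_toP_tmul, mulOdd_toP_tmul]

theorem mulOdd_mul_mulOdd (y z : V₁) :
    (mulOdd y * mulOdd z : Module.End ℂ (P V₀ V₁)) = -(mulOdd z * mulOdd y) := by
  refine end_ext fun s t => ?_
  simp [mulOdd_toP_tmul, ← mul_assoc, ι_mul_ι_swap y z, TensorProduct.tmul_neg]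

variable (V₀ V₁) in
/-- Multiplication by an even vector, as a linear map in the vector. -/
noncomputable def mulEvenₗ : V₀ →ₗ[ℂ] Module.End ℂ (P V₀ V₁) where
  toFun := mulEven
  map_add' x y := end_ext fun s t => by
    simp [mulEven_toP_tmul, add_mul, TensorProduct.add_tmul]
  map_smul' c x := end_ext fun s t => by
    simp [mulEven_toP_tmul, ← TensorProduct.smul_tmul']

variable (V₀ V₁) in
/-- Multiplication by an odd vector, as a linear map in the vector. -/
noncomputable def mulOddₗ : V₁ →ₗ[ℂ] Module.End ℂ (P V₀ V₁) where
  toFun := mulOdd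
  map_add' x y := end_ext fun s t => by
    simp [mulOdd_toP_tmul, add_mul, TensorProduct.tmul_add]
  map_smul' c x := end_ext fun s t => by
    simp [mulOdd_toP_tmul]

variable (V₀ V₁) in
/-- The vacuum vector `1 ∈ P(V)`. -/
noncomputable def vacuum : P V₀ V₁ := toP V₀ V₁ (1 ⊗ₜ 1)

/-- The tensor product of the two augmentations sends `1 ⊗ 1` to `1`. -/
theorem vacuum_ne_zero : vacuum V₀ V₁ ≠ 0 := by
  intro h
  have h2 := congrArg ((TensorProduct.lid ℂ ℂ).toLinearMap ∘ₗ TensorProduct.map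
    (SymmetricAlgebra.algebraMapInv (R := ℂ) (M := V₀)).toLinearMap
    (ExteriorAlgebra.algebraMapInv (R := ℂ) (M := V₁)).toLinearMap)
    ((LinearEquiv.map_eq_zero_iff _).1 h)
  simp at h2

theorem derivEven_vacuum (ξ : Module.Dual ℂ V₀) : derivEven ξ (vacuum V₀ V₁) = 0 := by
  simp [vacuum, derivEven_toP_tmul]

theorem derivOdd_vacuum (η : Module.Dual ℂ V₁) : derivOdd η (vacuum V₀ V₁) = 0 := by
  rw [vacuum, derivOdd_toP_tmul, CliffordAlgebra.contractLeft_one]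
  simp

/-- A subspace of `P(V)` containing `1` and stable under multiplication by `V` is everything. -/
theorem eq_top_of_vacuum_mem (N : Submodule ℂ (P V₀ V₁)) (h1 : vacuum V₀ V₁ ∈ N)
    (he : ∀ x, ∀ p ∈ N, mulEven x p ∈ N) (ho : ∀ y, ∀ p ∈ N, mulOdd y p ∈ N) : N = ⊤ := by
  have hS : ∀ s : SymmetricAlgebra ℂ V₀, ∀ p ∈ N,
      mapP (LinearMap.mulLeft ℂ s) LinearMap.id p ∈ N := by
    intro s
    induction s using SymmetricAlgebra.induction with
    | algebraMap r =>
      intro p hp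
      have : (mapP (LinearMap.mulLeft ℂ (algebraMap ℂ (SymmetricAlgebra ℂ V₀) r)) LinearMap.id :
          Module.End ℂ (P V₀ V₁)) = r • 1 := end_ext fun s t => by
        simp [← Algebra.smul_def, ← TensorProduct.smul_tmul']
      rw [this]
      exact N.smul_mem r hp
    | ι x => exact he x
    | mul a b ha hb =>
      intro p hp
      rw [LinearMap.mulLeft_mul, ← LinearMap.id_comp (LinearMap.id), mapP_comp]
      exact ha _ (hb _ hp)
    | add a b ha hb =>
      intro p hp
      have : (mapP (LinearMap.mulLeft ℂ (a + b)) LinearMap.id : Module.End ℂ (P V₀ V₁)) =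
          mapP (LinearMap.mulLeft ℂ a) LinearMap.id +
            mapP (LinearMap.mulLeft ℂ b) LinearMap.id := end_ext fun s t => by
        simp [add_mul, TensorProduct.add_tmul]
      rw [this]
      exact N.add_mem (ha p hp) (hb p hp)
  have hΛ : ∀ t : ExteriorAlgebra ℂ V₁, ∀ p ∈ N,
      mapP LinearMap.id (LinearMap.mulLeft ℂ t) p ∈ N := by
    intro t
    induction t using ExteriorAlgebra.induction with
    | algebraMap r =>
      intro p hp
      have : (mapP LinearMap.id (LinearMap.mulLeft ℂ (algebraMap ℂ (ExteriorAlgebra ℂ V₁) r)) :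
          Module.End ℂ (P V₀ V₁)) = r • 1 := end_ext fun s t => by
        simp [← Algebra.smul_def]
      rw [this]
      exact N.smul_mem r hp
    | ι y => exact ho y
    | mul a b ha hb =>
      intro p hp
      rw [LinearMap.mulLeft_mul, ← LinearMap.id_comp (LinearMap.id), mapP_comp]
      exact ha _ (hb _ hp)
    | add a b ha hb =>
      intro p hp
      have : (mapP LinearMap.id (LinearMap.mulLeft ℂ (a + b)) : Module.End ℂ (P V₀ V₁)) =
          mapP LinearMap.id (LinearMap.mulLeft ℂ a) +
            mapP LinearMap.id (LinearMap.mulLeft ℂ b) := end_ext fun s t => by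
        simp [add_mul, TensorProduct.tmul_add]
      rw [this]
      exact N.add_mem (ha p hp) (hb p hp)
  refine eq_top_iff.2 fun p _ => ?_
  induction p using toP_induction with
  | zero => exact N.zero_mem
  | add p q hp hq => exact N.add_mem (hp trivial) (hq trivial)
  | tmul s t =>
    have := hS s _ (hΛ t _ h1)
    simpa [vacuum] using this

variable (V₀ V₁) in
/-- The homogeneous component of degree `n` of `P(V)`. -/
noncomputable def homogeneous : ℕ → Submodule ℂ (P V₀ V₁)
  | 0 => Submodule.span ℂ {vacuum V₀ V₁}
  | n + 1 => (⨆ x : V₀, (homogeneous n).map (mulEven x)) ⊔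
      ⨆ y : V₁, (homogeneous n).map (mulOdd y)

theorem mulEven_mem_homogeneous {n : ℕ} (x : V₀) {p : P V₀ V₁} (hp : p ∈ homogeneous V₀ V₁ n) :
    mulEven x p ∈ homogeneous V₀ V₁ (n + 1) :=
  Submodule.mem_sup_left (Submodule.mem_iSup_of_mem x (Submodule.mem_map_of_mem hp))

theorem mulOdd_mem_homogeneous {n : ℕ} (y : V₁) {p : P V₀ V₁} (hp : p ∈ homogeneous V₀ V₁ n) :
    mulOdd y p ∈ homogeneous V₀ V₁ (n + 1) :=
  Submodule.mem_sup_right (Submodule.mem_iSup_of_mem y (Submodule.mem_map_of_mem hp))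

theorem homogeneous_succ_le {n : ℕ} {N : Submodule ℂ (P V₀ V₁)}
    (he : ∀ x, ∀ p ∈ homogeneous V₀ V₁ n, mulEven x p ∈ N)
    (ho : ∀ y, ∀ p ∈ homogeneous V₀ V₁ n, mulOdd y p ∈ N) : homogeneous V₀ V₁ (n + 1) ≤ N :=
  sup_le (iSup_le fun x => Submodule.map_le_iff_le_comap.2 fun p hp => he x p hp)
    (iSup_le fun y => Submodule.map_le_iff_le_comap.2 fun p hp => ho y p hp)

/-- Only the fact that the homogeneous pieces span is needed; their independence plays no role in
what follows. -/
theorem iSup_homogeneous : ⨆ n, homogeneous V₀ V₁ n = ⊤ := by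
  refine eq_top_of_vacuum_mem _
    (Submodule.mem_iSup_of_mem 0 (Submodule.mem_span_singleton_self _)) (fun x p hp => ?_)
    fun y p hp => ?_
  · induction hp using Submodule.iSup_induction' with
    | mem n p hp => exact Submodule.mem_iSup_of_mem (n + 1) (mulEven_mem_homogeneous x hp)
    | zero => simp
    | add p q _ _ hp hq => rw [map_add]; exact add_mem hp hq
  · induction hp using Submodule.iSup_induction' with
    | mem n p hp => exact Submodule.mem_iSup_of_mem (n + 1) (mulOdd_mem_homogeneous y hp)
    | zero => simp
    | add p q _ _ hp hq => rw [map_add]; exact add_mem hp hq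

/-- An operator on `P(V)` which is one of the partial derivatives. -/
def IsPartialDerivative (D : Module.End ℂ (P V₀ V₁)) : Prop :=
  (∃ ξ, D = derivEven ξ) ∨ ∃ η, D = derivOdd η

theorem IsPartialDerivative.vacuum {D : Module.End ℂ (P V₀ V₁)} (hD : IsPartialDerivative D) :
    D (vacuum V₀ V₁) = 0 := by
  rcases hD with ⟨ξ, rfl⟩ | ⟨η, rfl⟩
  exacts [derivEven_vacuum ξ, derivOdd_vacuum η]

theorem IsPartialDerivative.apply_eq_zero {D : Module.End ℂ (P V₀ V₁)}
    (hD : IsPartialDerivative D) {p : P V₀ V₁} (hp : p ∈ homogeneous V₀ V₁ 0) : D p = 0 := by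
  obtain ⟨c, rfl⟩ := Submodule.mem_span_singleton.1 hp
  rw [map_smul, hD.vacuum, smul_zero]

theorem IsPartialDerivative.apply_mem {D : Module.End ℂ (P V₀ V₁)} (hD : IsPartialDerivative D)
    {n : ℕ} {p : P V₀ V₁} (hp : p ∈ homogeneous V₀ V₁ (n + 1)) : D p ∈ homogeneous V₀ V₁ n := by
  -- Commuting `D` past a multiplication leaves a scalar multiple of `q` and, up to sign, the
  -- multiplication applied to `D q`. Assuming that the latter lies in degree `n`, rather than `D q`
  -- in degree `n - 1`, treats `n = 0`, where `D q = 0`, together with the other degrees.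
  have key : ∀ n : ℕ, (∀ q ∈ homogeneous V₀ V₁ n,
      (∀ x, mulEven x (D q) ∈ homogeneous V₀ V₁ n) ∧
        ∀ y, mulOdd y (D q) ∈ homogeneous V₀ V₁ n) →
      homogeneous V₀ V₁ (n + 1) ≤ (homogeneous V₀ V₁ n).comap D := by
    intro n h
    refine homogeneous_succ_le (fun x q hq => ?_) fun y q hq => ?_
    · rw [Submodule.mem_comap, ← Module.End.mul_apply]
      rcases hD with ⟨ξ, rfl⟩ | ⟨η, rfl⟩
      · rw [derivEven_mul_mulEven]
        exact add_mem ((h q hq).1 x) (Submodule.smul_mem _ _ hq)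
      · rw [derivOdd_mul_mulEven]
        exact (h q hq).1 x
    · rw [Submodule.mem_comap, ← Module.End.mul_apply]
      rcases hD with ⟨ξ, rfl⟩ | ⟨η, rfl⟩
      · rw [derivEven_mul_mulOdd]
        exact (h q hq).2 y
      · rw [derivOdd_mul_mulOdd]
        exact sub_mem (Submodule.smul_mem _ _ hq) ((h q hq).2 y)
  suffices h : homogeneous V₀ V₁ (n + 1) ≤ (homogeneous V₀ V₁ n).comap D from h hp
  clear hp
  induction n with
  | zero =>
    refine key 0 fun q hq => ?_
    simp [hD.apply_eq_zero hq]
  | succ n ih =>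
    exact key (n + 1) fun q hq =>
      ⟨fun x => mulEven_mem_homogeneous x (ih hq), fun y => mulOdd_mem_homogeneous y (ih hq)⟩

variable (V₀ V₁) in
/-- The elements of `P(V)` of degree at most `n`. -/
noncomputable def degreeLE : ℕ → Submodule ℂ (P V₀ V₁)
  | 0 => homogeneous V₀ V₁ 0
  | n + 1 => degreeLE n ⊔ homogeneous V₀ V₁ (n + 1)

theorem degreeLE_mono : Monotone (degreeLE V₀ V₁) :=
  monotone_nat_of_le_succ fun _ => le_sup_left

theorem homogeneous_le_degreeLE (n : ℕ) : homogeneous V₀ V₁ n ≤ degreeLE V₀ V₁ n := by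
  cases n with
  | zero => exact le_rfl
  | succ n => exact le_sup_right

theorem exists_mem_degreeLE (p : P V₀ V₁) : ∃ n, p ∈ degreeLE V₀ V₁ n := by
  rw [← Submodule.mem_iSup_of_directed _ degreeLE_mono.directed_le]
  have : p ∈ ⨆ n, homogeneous V₀ V₁ n := by rw [iSup_homogeneous]; trivial
  exact iSup_mono homogeneous_le_degreeLE this

theorem IsPartialDerivative.apply_mem_degreeLE {D : Module.End ℂ (P V₀ V₁)}
    (hD : IsPartialDerivative D) {n : ℕ} {p : P V₀ V₁} (hp : p ∈ degreeLE V₀ V₁ (n + 1)) :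
    D p ∈ degreeLE V₀ V₁ n := by
  induction n generalizing p with
  | zero =>
    obtain ⟨q, hq, r, hr, rfl⟩ := Submodule.mem_sup.1 hp
    rw [map_add, hD.apply_eq_zero hq, zero_add]
    exact hD.apply_mem hr
  | succ n ih =>
    obtain ⟨q, hq, r, hr, rfl⟩ := Submodule.mem_sup.1 hp
    rw [map_add]
    exact add_mem (degreeLE_mono n.le_succ (ih hq))
      (homogeneous_le_degreeLE _ (hD.apply_mem hr))

/-! ### The Euler operator, and vectors killed by all derivatives. -/

section Euler

theorem sum_coord_smul_mulEven [FiniteDimensional ℂ V₀] (x : V₀) :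
    ∑ i, (Module.finBasis ℂ V₀).coord i x • (mulEven (Module.finBasis ℂ V₀ i) :
      Module.End ℂ (P V₀ V₁)) = mulEven x := by
  change ∑ i, (Module.finBasis ℂ V₀).coord i x • mulEvenₗ V₀ V₁ _ = mulEvenₗ V₀ V₁ x
  simp_rw [← map_smul, ← map_sum]
  congr 1
  exact (Module.finBasis ℂ V₀).sum_repr x

theorem sum_coord_smul_mulOdd [FiniteDimensional ℂ V₁] (y : V₁) :
    ∑ i, (Module.finBasis ℂ V₁).coord i y • (mulOdd (Module.finBasis ℂ V₁ i) :
      Module.End ℂ (P V₀ V₁)) = mulOdd y := by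
  change ∑ i, (Module.finBasis ℂ V₁).coord i y • mulOddₗ V₀ V₁ _ = mulOddₗ V₀ V₁ y
  simp_rw [← map_smul, ← map_sum]
  congr 1
  exact (Module.finBasis ℂ V₁).sum_repr y

variable [FiniteDimensional ℂ V₀] [FiniteDimensional ℂ V₁]

variable (V₀ V₁) in
/-- The Euler operator of `P(V)`. -/
noncomputable def euler : Module.End ℂ (P V₀ V₁) :=
  (∑ i, mulEven (Module.finBasis ℂ V₀ i) * derivEven ((Module.finBasis ℂ V₀).coord i)) +
    ∑ j, mulOdd (Module.finBasis ℂ V₁ j) * derivOdd ((Module.finBasis ℂ V₁).coord j)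

theorem euler_mul_mulEven (x : V₀) :
    euler V₀ V₁ * mulEven x = mulEven x * euler V₀ V₁ + mulEven x := by
  conv_rhs => rw [← sum_coord_smul_mulEven (V₀ := V₀) (V₁ := V₁) x]
  rw [sum_coord_smul_mulEven, euler]
  simp only [add_mul, mul_add, Finset.sum_mul, Finset.mul_sum, mul_assoc, derivEven_mul_mulEven,
    derivOdd_mul_mulEven, Finset.sum_add_distrib, mul_smul_comm, mul_one,
    sum_coord_smul_mulEven]
  simp only [← mul_assoc, mulEven_mul_mulEven _ x, ← mulEven_mul_mulOdd x]
  abel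

theorem euler_mul_mulOdd (y : V₁) :
    euler V₀ V₁ * mulOdd y = mulOdd y * euler V₀ V₁ + mulOdd y := by
  rw [euler]
  simp only [add_mul, mul_add, Finset.sum_mul, Finset.mul_sum, mul_assoc, derivEven_mul_mulOdd,
    derivOdd_mul_mulOdd, mul_sub, Finset.sum_sub_distrib, mul_smul_comm, mul_one,
    sum_coord_smul_mulOdd]
  simp only [← mul_assoc, mulEven_mul_mulOdd _ y, mulOdd_mul_mulOdd _ y, neg_mul,
    Finset.sum_neg_distrib]
  abel

theorem euler_apply_homogeneous {n : ℕ} {p : P V₀ V₁} (hp : p ∈ homogeneous V₀ V₁ n) :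
    euler V₀ V₁ p = (n : ℂ) • p := by
  suffices h : homogeneous V₀ V₁ n ≤ LinearMap.eqLocus (euler V₀ V₁) ((n : ℂ) • LinearMap.id) from
    h hp
  clear hp
  induction n with
  | zero =>
    rw [homogeneous, Submodule.span_singleton_le_iff_mem, LinearMap.mem_eqLocus]
    simp [euler, derivEven_vacuum, derivOdd_vacuum]
  | succ n ih =>
    refine homogeneous_succ_le (fun x p hp => ?_) fun y p hp => ?_
    · rw [LinearMap.mem_eqLocus, ← Module.End.mul_apply, euler_mul_mulEven]
      have := ih hp
      rw [LinearMap.mem_eqLocus] at this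
      simp [this, add_smul]
    · rw [LinearMap.mem_eqLocus, ← Module.End.mul_apply, euler_mul_mulOdd]
      have := ih hp
      rw [LinearMap.mem_eqLocus] at this
      simp [this, add_smul]

theorem euler_apply_mem_degreeLE {n : ℕ} {p : P V₀ V₁} (hp : p ∈ degreeLE V₀ V₁ n) :
    euler V₀ V₁ p ∈ degreeLE V₀ V₁ n := by
  induction n generalizing p with
  | zero => rw [euler_apply_homogeneous hp]; exact Submodule.smul_mem _ _ hp
  | succ n ih =>
    obtain ⟨q, hq, r, hr, rfl⟩ := Submodule.mem_sup.1 hp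
    rw [map_add, euler_apply_homogeneous hr]
    exact add_mem (Submodule.mem_sup_left (ih hq))
      (Submodule.mem_sup_right (Submodule.smul_mem _ _ hr))

/-- An element of `P(V)` annihilated by all partial derivatives is a constant. -/
theorem mem_span_vacuum_of_deriv_eq_zero {p : P V₀ V₁}
    (h : ∀ D : Module.End ℂ (P V₀ V₁), IsPartialDerivative D → D p = 0) :
    p ∈ Submodule.span ℂ {vacuum V₀ V₁} := by
  have hE : euler V₀ V₁ p = 0 := by
    simp [euler, h _ (Or.inl ⟨_, rfl⟩), h _ (Or.inr ⟨_, rfl⟩)]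
  obtain ⟨n, hn⟩ := exists_mem_degreeLE p
  induction n with
  | zero => exact hn
  | succ n ih =>
    -- Let `r` be the part of `p` of degree `n + 1` and `q` the rest. Then `0 = E p = E q + (n + 1)
    -- r`, where `E q` has degree at most `n`; dividing by `n + 1` shows that `r`, hence `p`, has
    -- degree at most `n`.
    refine ih ?_
    obtain ⟨q, hq, r, hr, rfl⟩ := Submodule.mem_sup.1 hn
    rw [map_add, euler_apply_homogeneous hr] at hE
    have hne : ((n + 1 : ℕ) : ℂ) ≠ 0 := by exact_mod_cast n.succ_ne_zero
    have : r = ((n + 1 : ℕ) : ℂ)⁻¹ • -euler V₀ V₁ q := by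
      rw [eq_inv_smul_iff₀ hne, eq_neg_iff_add_eq_zero, add_comm, hE]
    rw [this]
    exact add_mem hq (Submodule.smul_mem _ _ (neg_mem (euler_apply_mem_degreeLE hq)))

end Euler

/-! ### Irreducibility of `P(V)` over `PD(V)` and density. -/

theorem mulEven_mem_PD (x : V₀) : mulEven x ∈ PD V₀ V₁ :=
  Algebra.subset_adjoin (.inl (.inl (.inl ⟨x, rfl⟩)))

theorem mulOdd_mem_PD (y : V₁) : mulOdd y ∈ PD V₀ V₁ :=
  Algebra.subset_adjoin (.inl (.inl (.inr ⟨y, rfl⟩)))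

theorem IsPartialDerivative.mem_PD {D : Module.End ℂ (P V₀ V₁)} (hD : IsPartialDerivative D) :
    D ∈ PD V₀ V₁ := by
  rcases hD with ⟨ξ, rfl⟩ | ⟨η, rfl⟩
  exacts [Algebra.subset_adjoin (.inl (.inr ⟨ξ, rfl⟩)), Algebra.subset_adjoin (.inr ⟨η, rfl⟩)]

theorem PD_submodule_eq_top (N : Submodule (PD V₀ V₁) (P V₀ V₁)) (h : vacuum V₀ V₁ ∈ N) :
    N = ⊤ := by
  have := eq_top_of_vacuum_mem (N.restrictScalars ℂ) h
    (fun x p hp => N.smul_mem ⟨_, mulEven_mem_PD x⟩ hp)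
    (fun y p hp => N.smul_mem ⟨_, mulOdd_mem_PD y⟩ hp)
  exact (Submodule.restrictScalars_eq_top_iff ℂ _ _).1 this

variable [FiniteDimensional ℂ V₀] [FiniteDimensional ℂ V₁]

/-- Induction on the degree: either some derivative of `p` is nonzero, and it has smaller degree, or
all vanish and `p` is a nonzero constant. -/
theorem vacuum_mem_of_ne_zero (N : Submodule (PD V₀ V₁) (P V₀ V₁)) {p : P V₀ V₁} (hp : p ∈ N)
    (hp0 : p ≠ 0) : vacuum V₀ V₁ ∈ N := by
  obtain ⟨n, hn⟩ := exists_mem_degreeLE p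
  induction n generalizing p with
  | zero =>
    obtain ⟨c, rfl⟩ := Submodule.mem_span_singleton.1 hn
    have hc : c ≠ 0 := fun h => hp0 (by simp [h])
    exact ((N.restrictScalars ℂ).smul_mem_iff hc).1 hp
  | succ n ih =>
    by_cases h : ∀ D : Module.End ℂ (P V₀ V₁), IsPartialDerivative D → D p = 0
    · obtain ⟨c, rfl⟩ := Submodule.mem_span_singleton.1 (mem_span_vacuum_of_deriv_eq_zero h)
      have hc : c ≠ 0 := fun h => hp0 (by simp [h])
      exact ((N.restrictScalars ℂ).smul_mem_iff hc).1 hp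
    · push Not at h
      obtain ⟨D, hD, hDp⟩ := h
      exact ih (N.smul_mem ⟨D, hD.mem_PD⟩ hp) hDp (hD.apply_mem_degreeLE hn)

/-- `P(V)` is an irreducible `PD(V)`-module. -/
instance isSimpleModule_P : IsSimpleModule (PD V₀ V₁) (P V₀ V₁) := by
  have : Nontrivial (P V₀ V₁) := ⟨_, _, vacuum_ne_zero⟩
  rw [isSimpleModule_iff]
  refine { eq_bot_or_eq_top := fun N => ?_ }
  by_cases hN : N = ⊥
  · exact .inl hN
  · obtain ⟨p, hp, hp0⟩ := N.ne_bot_iff.1 hN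
    exact .inr (PD_submodule_eq_top N (vacuum_mem_of_ne_zero N hp hp0))

/-- Schur's lemma by way of the vacuum, since `P(V)` may be infinite-dimensional. All derivatives
kill `T 1`, so `T 1 = c · 1`, and the kernel of `T - c` is a submodule containing `1`. -/
theorem exists_eq_smul_of_commute (T : Module.End (PD V₀ V₁) (P V₀ V₁)) :
    ∃ c : ℂ, ∀ p, T p = c • p := by
  have h : T (vacuum V₀ V₁) ∈ Submodule.span ℂ {vacuum V₀ V₁} := by
    refine mem_span_vacuum_of_deriv_eq_zero fun D hD => ?_
    have := T.map_smul (⟨D, hD.mem_PD⟩ : PD V₀ V₁) (vacuum V₀ V₁)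
    change T (D _) = D (T _) at this
    rw [← this, hD.vacuum, map_zero]
  obtain ⟨c, hc⟩ := Submodule.mem_span_singleton.1 h
  refine ⟨c, fun p => ?_⟩
  have htop := PD_submodule_eq_top (LinearMap.ker (T - c • LinearMap.id)) (by simp [hc])
  have hp : p ∈ LinearMap.ker (T - c • LinearMap.id) := by rw [htop]; trivial
  simpa [sub_eq_zero] using hp

/-- Every linear map from a finite-dimensional subspace of `P(V)` to `P(V)` is given by a
polynomial coefficient differential operator. -/
theorem exists_mem_PD_apply_eq (X : Submodule ℂ (P V₀ V₁)) [FiniteDimensional ℂ X]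
    (T : X →ₗ[ℂ] P V₀ V₁) : ∃ r ∈ PD V₀ V₁, ∀ x : X, r x = T x := by
  classical
  obtain ⟨T', hT'⟩ := LinearMap.exists_extend T
  let F : Module.End (Module.End (PD V₀ V₁) (P V₀ V₁)) (P V₀ V₁) :=
    { toFun := T'
      map_add' := map_add T'
      map_smul' := fun e p => by
        obtain ⟨c, hc⟩ := exists_eq_smul_of_commute e
        simp [hc] }
  let b := Module.finBasis ℂ X
  obtain ⟨r, hr⟩ := jacobson_density (R := PD V₀ V₁) F (Finset.univ.image fun i => (b i : P V₀ V₁))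
  refine ⟨r, r.2, fun x => ?_⟩
  have h : (r : Module.End ℂ (P V₀ V₁)) ∘ₗ X.subtype = T := by
    refine b.ext fun i => ?_
    rw [← hT']
    exact (hr _ (Finset.mem_image_of_mem _ (Finset.mem_univ i))).symm
  exact LinearMap.congr_fun h x

end WeylClifford

end SuperDuality

namespace SuperDuality

/-! ### Regular functions under translation and inversion. -/

section RegularFunctions

variable {n : ℕ} {G : Subgroup (GL (Fin n) ℂ)}

theorem entry_mem_regularFunctions (i j : Fin n) :
    (fun g : G => ((g : GL (Fin n) ℂ) : Matrix (Fin n) (Fin n) ℂ) i j) ∈ regularFunctions G :=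
  Algebra.subset_adjoin (.inl ⟨(i, j), rfl⟩)

theorem inv_det_mem_regularFunctions :
    (fun g : G => (((g : GL (Fin n) ℂ) : Matrix (Fin n) (Fin n) ℂ).det)⁻¹) ∈
      regularFunctions G :=
  Algebra.subset_adjoin (.inr rfl)

theorem const_mem_regularFunctions (c : ℂ) : (fun _ : G => c) ∈ regularFunctions G :=
  (regularFunctions G).algebraMap_mem c

theorem sum_mem_regularFunctions {ι : Type*} (s : Finset ι) {f : ι → G → ℂ}
    (h : ∀ i ∈ s, f i ∈ regularFunctions G) :
    (fun g => ∑ i ∈ s, f i g) ∈ regularFunctions G := by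
  have := (regularFunctions G).sum_mem h
  convert this using 1
  ext g
  simp

theorem prod_mem_regularFunctions {ι : Type*} (s : Finset ι) {f : ι → G → ℂ}
    (h : ∀ i ∈ s, f i ∈ regularFunctions G) :
    (fun g => ∏ i ∈ s, f i g) ∈ regularFunctions G := by
  have := (regularFunctions G).prod_mem h
  convert this using 1
  ext g
  simp

/-- The determinant of a matrix of regular functions is regular. -/
theorem det_mem_regularFunctions {F : G → Matrix (Fin n) (Fin n) ℂ}
    (h : ∀ i j, (fun g => F g i j) ∈ regularFunctions G) :
    (fun g => (F g).det) ∈ regularFunctions G := by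
  simp_rw [Matrix.det_apply']
  exact sum_mem_regularFunctions _ fun σ _ => (regularFunctions G).mul_mem
    (const_mem_regularFunctions _) (prod_mem_regularFunctions _ fun i _ => h _ _)

theorem comp_mem_regularFunctions {φ : G → G}
    (h1 : ∀ i j, (fun g => ((φ g : GL (Fin n) ℂ) : Matrix (Fin n) (Fin n) ℂ) i j) ∈
      regularFunctions G)
    (h2 : (fun g => (((φ g : GL (Fin n) ℂ) : Matrix (Fin n) (Fin n) ℂ).det)⁻¹) ∈
      regularFunctions G)
    {f : G → ℂ} (hf : f ∈ regularFunctions G) : (fun g => f (φ g)) ∈ regularFunctions G := by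
  induction hf using Algebra.adjoin_induction with
  | mem f hf =>
    rcases hf with ⟨⟨i, j⟩, rfl⟩ | rfl
    exacts [h1 i j, h2]
  | algebraMap c => exact const_mem_regularFunctions c
  | add f g _ _ hf hg => exact (regularFunctions G).add_mem hf hg
  | mul f g _ _ hf hg => exact (regularFunctions G).mul_mem hf hg

theorem comp_mul_right_mem_regularFunctions (h : G) {f : G → ℂ} (hf : f ∈ regularFunctions G) :
    (fun g => f (g * h)) ∈ regularFunctions G := by
  refine comp_mem_regularFunctions (fun i j => ?_) ?_ hf
  · simp only [Subgroup.coe_mul, Units.val_mul, Matrix.mul_apply]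
    exact sum_mem_regularFunctions _ fun l _ => (regularFunctions G).mul_mem
      (entry_mem_regularFunctions _ _) (const_mem_regularFunctions _)
  · simp only [Subgroup.coe_mul, Units.val_mul, Matrix.det_mul, mul_inv]
    exact (regularFunctions G).mul_mem inv_det_mem_regularFunctions (const_mem_regularFunctions _)

theorem comp_inv_mem_regularFunctions {f : G → ℂ} (hf : f ∈ regularFunctions G) :
    (fun g => f g⁻¹) ∈ regularFunctions G := by
  refine comp_mem_regularFunctions (fun i j => ?_) ?_ hf
  -- Cramer's rule: an entry of `g⁻¹` is `det(g)⁻¹` times the determinant of `g` with one row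
  -- replaced by a constant one.
  · simp only [Subgroup.coe_inv, Matrix.coe_units_inv, Matrix.inv_def, Matrix.smul_apply,
      Ring.inverse_eq_inv', smul_eq_mul, Matrix.adjugate_apply]
    refine (regularFunctions G).mul_mem inv_det_mem_regularFunctions
      (det_mem_regularFunctions fun a b => ?_)
    by_cases hab : a = j
    · subst hab
      simpa using const_mem_regularFunctions _
    · simpa [Matrix.updateRow_ne hab] using entry_mem_regularFunctions a b
  · simp only [Subgroup.coe_inv, Matrix.coe_units_inv, Matrix.det_nonsing_inv,
      Ring.inverse_eq_inv', inv_inv]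
    exact det_mem_regularFunctions entry_mem_regularFunctions

end RegularFunctions

/-! ### Regular maps into possibly infinite-dimensional spaces. -/

section RegularMaps

variable {n : ℕ} {G : Subgroup (GL (Fin n) ℂ)}

/-- The regular maps from `G` to a complex vector space: those of the form `∑ fᵢ mᵢ` with
`fᵢ` regular functions. -/
def regularMaps (G : Subgroup (GL (Fin n) ℂ)) (M : Type*) [AddCommGroup M] [Module ℂ M] :
    Submodule ℂ (G → M) :=
  Submodule.span ℂ {F | ∃ f ∈ regularFunctions G, ∃ m : M, F = fun g => f g • m}

variable {M N : Type*} [AddCommGroup M] [Module ℂ M] [AddCommGroup N] [Module ℂ N]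

theorem smul_mem_regularMaps {f : G → ℂ} (hf : f ∈ regularFunctions G) (m : M) :
    (fun g => f g • m) ∈ regularMaps G M :=
  Submodule.subset_span ⟨f, hf, m, rfl⟩

theorem const_mem_regularMaps (m : M) : (fun _ : G => m) ∈ regularMaps G M := by
  simpa using smul_mem_regularMaps (const_mem_regularFunctions (G := G) 1) m

theorem sum_mem_regularMaps {ι : Type*} (s : Finset ι) {F : ι → G → M}
    (h : ∀ i ∈ s, F i ∈ regularMaps G M) : (fun g => ∑ i ∈ s, F i g) ∈ regularMaps G M := by
  have := (regularMaps G M).sum_mem h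
  convert this using 1
  ext g
  simp

theorem map_mem_regularMaps (T : M →ₗ[ℂ] N) {F : G → M} (hF : F ∈ regularMaps G M) :
    (fun g => T (F g)) ∈ regularMaps G N := by
  suffices h : regularMaps G M ≤ (regularMaps G N).comap (T.compLeft G) from h hF
  refine Submodule.span_le.2 ?_
  rintro _ ⟨f, hf, m, rfl⟩
  have := smul_mem_regularMaps hf (T m)
  simp_rw [← map_smul] at this
  exact this

theorem smul_fun_mem_regularMaps {f : G → ℂ} (hf : f ∈ regularFunctions G) {F : G → M}
    (hF : F ∈ regularMaps G M) : (fun g => f g • F g) ∈ regularMaps G M := by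
  suffices h : regularMaps G M ≤ (regularMaps G M).comap
      (LinearMap.pi fun g => f g • LinearMap.proj g) from h hF
  refine Submodule.span_le.2 ?_
  rintro _ ⟨f', hf', m, rfl⟩
  have := smul_mem_regularMaps ((regularFunctions G).mul_mem hf hf') m
  simp only [Pi.mul_apply, mul_smul] at this
  exact this

theorem mul_mem_regularMaps {A : Type*} [Ring A] [Algebra ℂ A] {F F' : G → A}
    (hF : F ∈ regularMaps G A) (hF' : F' ∈ regularMaps G A) :
    F * F' ∈ regularMaps G A := by
  suffices h : regularMaps G A ≤ (regularMaps G A).comap (LinearMap.mulRight ℂ F') from h hF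
  refine Submodule.span_le.2 ?_
  rintro _ ⟨f, hf, m, rfl⟩
  have := smul_fun_mem_regularMaps hf (map_mem_regularMaps (LinearMap.mulLeft ℂ m) hF')
  simp only [LinearMap.mulLeft_apply, ← smul_mul_assoc] at this
  exact this

theorem dual_comp_mem_regularFunctions (φ : Module.Dual ℂ M) {F : G → M}
    (hF : F ∈ regularMaps G M) : (fun g => φ (F g)) ∈ regularFunctions G := by
  suffices h : regularMaps G M ≤
      (Subalgebra.toSubmodule (regularFunctions G)).comap (φ.compLeft G) from h hF
  refine Submodule.span_le.2 ?_
  rintro _ ⟨f, hf, m, rfl⟩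
  have := (regularFunctions G).mul_mem hf (const_mem_regularFunctions (φ m))
  have h2 : (φ.compLeft G) (fun g => f g • m) = f * fun _ => φ m := by
    ext g
    simp
  change (φ.compLeft G) (fun g => f g • m) ∈ regularFunctions G
  rwa [h2]

theorem comp_mul_right_mem_regularMaps (h : G) {F : G → M} (hF : F ∈ regularMaps G M) :
    (fun g => F (g * h)) ∈ regularMaps G M := by
  induction hF using Submodule.span_induction with
  | mem F hF =>
    obtain ⟨f, hf, m, rfl⟩ := hF
    exact smul_mem_regularMaps (comp_mul_right_mem_regularFunctions h hf) m
  | zero => exact (regularMaps G M).zero_mem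
  | add F F' _ _ h h' => exact (regularMaps G M).add_mem h h'
  | smul c F _ h => exact (regularMaps G M).smul_mem c h

theorem finiteDimensional_span_range {F : G → M} (hF : F ∈ regularMaps G M) :
    FiniteDimensional ℂ (Submodule.span ℂ (Set.range F)) := by
  suffices h : ∃ W : Submodule ℂ M, FiniteDimensional ℂ W ∧ ∀ g, F g ∈ W by
    obtain ⟨W, _, hW⟩ := h
    exact Submodule.finiteDimensional_of_le
      (Submodule.span_le.2 (Set.range_subset_iff.2 hW))
  induction hF using Submodule.span_induction with
  | mem F hF =>
    obtain ⟨f, hf, m, rfl⟩ := hF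
    exact ⟨Submodule.span ℂ {m}, inferInstance, fun g =>
      Submodule.smul_mem _ _ (Submodule.mem_span_singleton_self m)⟩
  | zero => exact ⟨⊥, inferInstance, fun g => Submodule.zero_mem _⟩
  | add F F' _ _ h h' =>
    obtain ⟨W, _, hW⟩ := h
    obtain ⟨W', _, hW'⟩ := h'
    exact ⟨W ⊔ W', inferInstance, fun g => Submodule.add_mem_sup (hW g) (hW' g)⟩
  | smul c F _ h =>
    obtain ⟨W, _, hW⟩ := h
    exact ⟨W, inferInstance, fun g => W.smul_mem c (hW g)⟩

/-- The orbit maps of a regular representation are regular. -/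
theorem IsRegularRep.orbit_mem_regularMaps [FiniteDimensional ℂ M] {σ : Representation ℂ G M}
    (hσ : IsRegularRep G σ) (x : M) : (fun g => σ g x) ∈ regularMaps G M := by
  let b := Module.finBasis ℂ M
  have h : (fun g => σ g x) = fun g => ∑ i, b.coord i (σ g x) • b i := by
    ext g
    exact (b.sum_repr _).symm
  rw [h]
  exact sum_mem_regularMaps _ fun i _ => smul_mem_regularMaps (hσ (b.coord i) x) (b i)

end RegularMaps

/-! ### Complete reducibility of locally regular representations. -/

section Semisimple

open scoped MonoidAlgebra

/-- A linear equivalence intertwining a representation with the action on a module over the group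
algebra is linear over the group algebra. -/
noncomputable def asModuleEquivOfComm {k G W N : Type*} [Field k] [Group G] [AddCommGroup W]
    [Module k W] [AddCommGroup N] [Module k N] [Module k[G] N] [IsScalarTower k k[G] N]
    (σ : Representation k G W) (e : W ≃ₗ[k] N)
    (h : ∀ g x, e (σ g x) = MonoidAlgebra.single g (1 : k) • e x) : σ.asModule ≃ₗ[k[G]] N :=
  LinearEquiv.ofBijective
    (MonoidAlgebra.equivariantOfLinearOfComm (σ.asModuleEquiv.trans e).toLinearMap
      fun g x => by
        rw [Representation.single_smul, one_smul]
        exact h g x)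
    (σ.asModuleEquiv.trans e).bijective

theorem ofModule'_apply {k G N : Type*} [Field k] [Group G] [AddCommGroup N] [Module k N]
    [Module k[G] N] [IsScalarTower k k[G] N] (g : G) (x : N) :
    Representation.ofModule' (k := k) (G := G) N g x = MonoidAlgebra.single g (1 : k) • x := rfl

/-- An isomorphism between the representations attached to two modules over the group algebra is
linear over the group algebra. -/
noncomputable def linearEquivOfEquiv {k G N N' : Type*} [Field k] [Group G] [AddCommGroup N]
    [Module k N] [Module k[G] N] [IsScalarTower k k[G] N] [AddCommGroup N'] [Module k N']
    [Module k[G] N'] [IsScalarTower k k[G] N']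
    (φ : (Representation.ofModule' (k := k) (G := G) N).Equiv
      (Representation.ofModule' (k := k) (G := G) N')) : N ≃ₗ[k[G]] N' :=
  (asModuleEquivOfComm (Representation.ofModule' (k := k) (G := G) N) (LinearEquiv.refl k N)
    fun _ _ => rfl).symm.trans
    (asModuleEquivOfComm (Representation.ofModule' (k := k) (G := G) N) φ.toLinearEquiv
      fun g x => φ.toIntertwiningMap.isIntertwining _ _ g x)

theorem isIrreducible_ofModule' {k G N : Type*} [Field k] [Group G] [AddCommGroup N] [Module k N]
    [Module k[G] N] [IsScalarTower k k[G] N] [IsSimpleModule k[G] N] :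
    (Representation.ofModule' (k := k) (G := G) N).IsIrreducible := by
  rw [Representation.irreducible_iff_isSimpleModule_asModule]
  exact IsSimpleModule.congr (asModuleEquivOfComm _ (LinearEquiv.refl k N) fun g x => rfl)

/-- The module over the group algebra attached to a representation. -/
def GroupAlgebraModule {k G M : Type*} [Field k] [Group G] [AddCommGroup M] [Module k M]
    (_ : Representation k G M) : Type _ := M

namespace GroupAlgebraModule

variable {k G M : Type*} [Field k] [Group G] [AddCommGroup M] [Module k M]
  (ρ : Representation k G M)

instance : AddCommGroup (GroupAlgebraModule ρ) := inferInstanceAs (AddCommGroup M)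

instance : Module k (GroupAlgebraModule ρ) := inferInstanceAs (Module k M)

/-- The identity map from the space of a representation to the attached module. -/
def equiv : M ≃ₗ[k] GroupAlgebraModule ρ := LinearEquiv.refl k M

noncomputable instance : Module k[G] (GroupAlgebraModule ρ) :=
  Module.compHom (GroupAlgebraModule ρ)
    (((equiv ρ).conjRingEquiv.toRingHom).comp ρ.asAlgebraHom.toRingHom)

theorem smul_equiv (a : k[G]) (x : M) : a • equiv ρ x = equiv ρ (ρ.asAlgebraHom a x) := rfl

theorem single_smul_equiv (g : G) (x : M) :
    MonoidAlgebra.single g (1 : k) • equiv ρ x = equiv ρ (ρ g x) := by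
  rw [smul_equiv, Representation.asAlgebraHom_single_one]

instance : IsScalarTower k k[G] (GroupAlgebraModule ρ) where
  smul_assoc c a x := by
    obtain ⟨x, rfl⟩ := (equiv ρ).surjective x
    rw [smul_equiv, smul_equiv, map_smul, LinearMap.smul_apply, map_smul]

variable {ρ} in
/-- An invariant subspace as a submodule. -/
def submodule (K : Submodule k M) (hK : ∀ g, ∀ x ∈ K, ρ g x ∈ K) :
    Submodule k[G] (GroupAlgebraModule ρ) where
  __ := K.map (equiv ρ).toLinearMap
  smul_mem' a x hx := by
    obtain ⟨x, hx, rfl⟩ := hx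
    induction a using MonoidAlgebra.induction_linear with
    | zero => rw [zero_smul]; exact Submodule.zero_mem _
    | add a b ha hb => rw [add_smul]; exact Submodule.add_mem _ ha hb
    | single g c =>
      refine ⟨c • ρ g x, K.smul_mem _ (hK g x hx), ?_⟩
      change _ = MonoidAlgebra.single g c • equiv ρ x
      rw [smul_equiv, Representation.asAlgebraHom_single]
      rfl

variable {ρ} in
theorem equiv_mem_submodule {K : Submodule k M} {hK : ∀ g, ∀ x ∈ K, ρ g x ∈ K} {x : M} :
    equiv ρ x ∈ submodule K hK ↔ x ∈ K := by
  constructor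
  · rintro ⟨y, hy, h⟩
    rwa [← (equiv ρ).injective h]
  · exact fun h => ⟨x, h, rfl⟩

variable {ρ} in
theorem mem_span_orbit {x y : M}
    (hy : equiv ρ y ∈ Submodule.span k[G] {equiv ρ x}) :
    y ∈ Submodule.span k (Set.range fun g => ρ g x) := by
  obtain ⟨a, ha⟩ := Submodule.mem_span_singleton.1 hy
  rw [smul_equiv] at ha
  rw [← (equiv ρ).injective ha]
  clear ha
  induction a using MonoidAlgebra.induction_linear with
  | zero => simp
  | add a b ha hb => rw [map_add, LinearMap.add_apply]; exact add_mem ha hb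
  | single g c =>
    rw [Representation.asAlgebraHom_single]
    exact Submodule.smul_mem _ _ (Submodule.subset_span ⟨g, rfl⟩)

end GroupAlgebraModule

open GroupAlgebraModule

variable {n : ℕ} {G : Subgroup (GL (Fin n) ℂ)}

/-- Complete reducibility for modules over the group algebra in an arbitrary universe. -/
theorem IsReductiveGroup.isSemisimpleModule (hG : IsReductiveGroup G) {N : Type*}
    [AddCommGroup N] [Module ℂ N] [FiniteDimensional ℂ N] [Module ℂ[G] N]
    [IsScalarTower ℂ ℂ[G] N] (h : IsRegularRep G (Representation.ofModule' (k := ℂ) (G := G) N)) :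
    IsSemisimpleModule ℂ[G] N := by
  -- Reductivity speaks only of spaces in `Type`, so the action is transported to `ℂ^d`.
  obtain ⟨d, ⟨e⟩⟩ : ∃ d : ℕ, Nonempty ((Fin d → ℂ) ≃ₗ[ℂ] N) :=
    ⟨_, ⟨(Module.finBasis ℂ N).equivFun.symm⟩⟩
  obtain ⟨σ, hσe⟩ : ∃ σ : Representation ℂ G (Fin d → ℂ), ∀ g x,
      e (σ g x) = MonoidAlgebra.single g (1 : ℂ) • e x :=
    ⟨(e.symm.conjRingEquiv.toMonoidHom).comp (Representation.ofModule' (k := ℂ) (G := G) N),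
      fun g x => e.apply_symm_apply _⟩
  have hσ : IsRegularRep G σ := fun φ x => by
    have := h (φ ∘ₗ e.symm.toLinearMap) (e x)
    convert this using 2 with g
    simp only [LinearMap.comp_apply, ofModule'_apply, ← hσe]
    simp
  have := (Representation.isSemisimpleRepresentation_iff_isSemisimpleModule_asModule σ).1
    (hG.completelyReducible _ σ hσ)
  exact IsSemisimpleModule.congr (asModuleEquivOfComm σ e hσe).symm

variable {M : Type*} [AddCommGroup M] [Module ℂ M] {ρ : Representation ℂ G M}

/-- The orbit map of `ρ h x` is the right translate by `h` of that of `x`, and regular maps are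
stable under right translation. -/
theorem orbit_mem_regularMaps_of_mem_span {x : M} (hx : (fun g => ρ g x) ∈ regularMaps G M)
    {y : M} (hy : y ∈ Submodule.span ℂ (Set.range fun g => ρ g x)) :
    (fun g => ρ g y) ∈ regularMaps G M := by
  suffices h : Submodule.span ℂ (Set.range fun g => ρ g x) ≤
      (regularMaps G M).comap (LinearMap.pi fun g => ρ g) from h hy
  refine Submodule.span_le.2 ?_
  rintro _ ⟨h, rfl⟩
  have := comp_mul_right_mem_regularMaps h hx
  simp only [map_mul, Module.End.mul_apply] at this
  exact this

theorem finiteDimensional_span_singleton {x : M} (hx : (fun g => ρ g x) ∈ regularMaps G M) :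
    FiniteDimensional ℂ (Submodule.span ℂ[G] {equiv ρ x}) := by
  have := finiteDimensional_span_range hx
  have h : (Submodule.span ℂ[G] {equiv ρ x}).restrictScalars ℂ ≤
      (Submodule.span ℂ (Set.range fun g => ρ g x)).map (equiv ρ).toLinearMap :=
    fun y hy => ⟨(equiv ρ).symm y, mem_span_orbit hy, rfl⟩
  exact Submodule.finiteDimensional_of_le h

/-- A submodule whose orbit maps are regular is a regular representation. -/
theorem isRegularRep_ofModule' (N : Submodule ℂ[G] (GroupAlgebraModule ρ))
    (h : ∀ x, equiv ρ x ∈ N → (fun g => ρ g x) ∈ regularMaps G M) :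
    IsRegularRep G (Representation.ofModule' (k := ℂ) (G := G) N) := by
  intro φ x
  obtain ⟨ψ, hψ⟩ := LinearMap.exists_extend (p := N.restrictScalars ℂ) φ
  obtain ⟨x, hx⟩ := x
  obtain ⟨x, rfl⟩ := (equiv ρ).surjective x
  convert dual_comp_mem_regularFunctions (ψ ∘ₗ (equiv ρ).toLinearMap) (h x hx) using 2 with g
  rw [← hψ, ofModule'_apply]
  exact congrArg ψ (single_smul_equiv ρ g x)

theorem isSemisimpleModule_span_singleton (hG : IsReductiveGroup G) {x : M}
    (hx : (fun g => ρ g x) ∈ regularMaps G M) :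
    IsSemisimpleModule ℂ[G] (Submodule.span ℂ[G] {equiv ρ x}) :=
  have := finiteDimensional_span_singleton hx
  hG.isSemisimpleModule
    (isRegularRep_ofModule' _ fun _ hy => orbit_mem_regularMaps_of_mem_span hx (mem_span_orbit hy))

/-- A representation of a reductive group with regular orbit maps is semisimple. -/
theorem isSemisimpleModule_groupAlgebraModule (hG : IsReductiveGroup G)
    (h : ∀ x, (fun g => ρ g x) ∈ regularMaps G M) :
    IsSemisimpleModule ℂ[G] (GroupAlgebraModule ρ) := by
  refine isSemisimpleModule_of_isSemisimpleModule_submodule'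
    (p := fun x : M => Submodule.span ℂ[G] {equiv ρ x})
    (fun x => isSemisimpleModule_span_singleton hG (h x)) (eq_top_iff.2 fun x _ => ?_)
  obtain ⟨x, rfl⟩ := (equiv ρ).surjective x
  exact Submodule.mem_iSup_of_mem x (Submodule.mem_span_singleton_self _)

theorem finiteDimensional_of_isSimpleModule (h : ∀ x, (fun g => ρ g x) ∈ regularMaps G M)
    (N : Submodule ℂ[G] (GroupAlgebraModule ρ)) [hN : IsSimpleModule ℂ[G] N] :
    FiniteDimensional ℂ N := by
  rw [isSimpleModule_iff_isAtom] at hN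
  obtain ⟨x, hx, hx0⟩ := N.ne_bot_iff.1 hN.1
  obtain ⟨x, rfl⟩ := (equiv ρ).surjective x
  -- A simple submodule lies in the cyclic submodule of any of its nonzero vectors, and that
  -- submodule is finite-dimensional.
  have hle : N ≤ Submodule.span ℂ[G] {equiv ρ x} := by
    rw [← hN.not_disjoint_iff_le, Submodule.disjoint_def]
    intro h0
    exact hx0 (h0 _ hx (Submodule.mem_span_singleton_self _))
  have : FiniteDimensional ℂ ((Submodule.span ℂ[G] {equiv ρ x}).restrictScalars ℂ) :=
    finiteDimensional_span_singleton (h x)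
  exact Submodule.finiteDimensional_of_le (S₁ := N.restrictScalars ℂ)
    (S₂ := (Submodule.span ℂ[G] {equiv ρ x}).restrictScalars ℂ) hle

/-- Lifting of invariants: a vector that is invariant modulo an invariant subspace `K` is
congruent modulo `K` to an invariant vector in the span of its orbit. -/
theorem exists_invariant_sub_mem (hG : IsReductiveGroup G) {x : M}
    (hx : (fun g => ρ g x) ∈ regularMaps G M) (K : Submodule ℂ M)
    (hK : ∀ g, ∀ y ∈ K, ρ g y ∈ K) (hxK : ∀ g, ρ g x - x ∈ K) :
    ∃ y ∈ Submodule.span ℂ (Set.range fun g => ρ g x), y - x ∈ K ∧ ∀ g, ρ g y = y := by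
  have := isSemisimpleModule_span_singleton hG hx
  set W := Submodule.span ℂ[G] {equiv ρ x} with hW
  -- Split the cyclic module `W` of `x` as `(K ∩ W) ⊕ C` and write `x = a + b` accordingly. The
  -- vector `ρ g b - b` lies in `C`, and also in `K` because `ρ g x - x` and `ρ g a - a` do; hence
  -- it is zero and `b` is invariant.
  obtain ⟨C, hC⟩ := exists_isCompl ((submodule K hK).comap W.subtype)
  obtain ⟨⟨a, haW⟩, ha, ⟨b, hbW⟩, hb, hab⟩ := Submodule.mem_sup.1
    (hC.sup_eq_top ▸ Submodule.mem_top : (⟨_, Submodule.mem_span_singleton_self _⟩ : W) ∈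
      (submodule K hK).comap W.subtype ⊔ C)
  obtain ⟨a, rfl⟩ := (equiv ρ).surjective a
  obtain ⟨b, rfl⟩ := (equiv ρ).surjective b
  have hab : a + b = x := (equiv ρ).injective (congrArg Subtype.val hab)
  have ha : a ∈ K := (equiv_mem_submodule (hK := hK)).1 ha
  refine ⟨b, mem_span_orbit hbW, ?_, fun g => ?_⟩
  · rw [← hab, sub_add_cancel_right]
    exact neg_mem ha
  · have hd : equiv ρ (ρ g b - b) ∈ W := by
      rw [map_sub, ← single_smul_equiv]
      exact sub_mem (W.smul_mem _ hbW) hbW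
    have hd1 : (⟨_, hd⟩ : W) ∈ (submodule K hK).comap W.subtype := by
      have h : ρ g b - b ∈ K := ?_
      · exact (equiv_mem_submodule (hK := hK)).2 h
      rw [eq_sub_of_add_eq' hab, map_sub, sub_sub_sub_comm]
      exact sub_mem (hxK g) (sub_mem (hK g a ha) ha)
    have hd2 : (⟨_, hd⟩ : W) ∈ C := by
      have h1 := sub_mem (C.smul_mem (MonoidAlgebra.single g (1 : ℂ)) hb) hb
      convert h1 using 1
      ext1
      exact (map_sub _ _ _).trans (congrArg (· - equiv ρ b) (single_smul_equiv ρ g b).symm)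
    have h0 := Submodule.disjoint_def.1 hC.disjoint _ hd1 hd2
    exact sub_eq_zero.1 ((equiv ρ).injective ((congrArg Subtype.val h0).trans (map_zero _).symm))

end Semisimple

end SuperDuality

namespace SuperDuality

open scoped MonoidAlgebra

/-! ### Conjugation by `G` on differential operators. -/

section Equivariance

variable {V₀ : Type u} {V₁ : Type v} [AddCommGroup V₀] [Module ℂ V₀] [AddCommGroup V₁]
  [Module ℂ V₁]

theorem symMap_ι {U : Type*} [AddCommGroup U] [Module ℂ U] (f : U →ₗ[ℂ] U) (x : U) :
    symMap f (SymmetricAlgebra.ι ℂ U x) = SymmetricAlgebra.ι ℂ U (f x) := by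
  simp [symMap]

/-- Both sides are derivations along `symMap f` that agree on generators. With `f = ρ₀ g` and the
dual action in `ξ`, this gives `conjRep_derivEven`. -/
theorem symMap_symDeriv {U : Type*} [AddCommGroup U] [Module ℂ U] (f : U →ₗ[ℂ] U)
    (ξ : Module.Dual ℂ U) (s : SymmetricAlgebra ℂ U) :
    symMap f (symDeriv (ξ ∘ₗ f) s) = symDeriv ξ (symMap f s) := by
  induction s using SymmetricAlgebra.induction with
  | algebraMap r => simp
  | ι x => simp [symMap_ι, symDeriv_ι]
  | mul a b ha hb => simp [Derivation.leibniz, ha, hb]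
  | add a b ha hb => simp [ha, hb]

theorem map_contractLeft {U : Type*} [AddCommGroup U] [Module ℂ U] (f : U →ₗ[ℂ] U)
    (η : Module.Dual ℂ U) (t : ExteriorAlgebra ℂ U) :
    ExteriorAlgebra.map f
        (CliffordAlgebra.contractLeft (Q := (0 : QuadraticForm ℂ U)) (η ∘ₗ f) t) =
      CliffordAlgebra.contractLeft (Q := (0 : QuadraticForm ℂ U)) η
        (ExteriorAlgebra.map f t) := by
  induction t using CliffordAlgebra.left_induction with
  | algebraMap r =>
    rw [CliffordAlgebra.contractLeft_algebraMap, map_zero]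
    exact ((congrArg (CliffordAlgebra.contractLeft (Q := (0 : QuadraticForm ℂ U)) η)
      (AlgHom.commutes (ExteriorAlgebra.map f) r)).trans
      (CliffordAlgebra.contractLeft_algebraMap (0 : QuadraticForm ℂ U) η r)).symm
  | add a b ha hb => rw [map_add, map_add, ha, hb, map_add, map_add]
  | ι_mul t x ht =>
    change ExteriorAlgebra.map f (CliffordAlgebra.contractLeft (Q := (0 : QuadraticForm ℂ U))
      (η ∘ₗ f) (ExteriorAlgebra.ι ℂ x * t)) = CliffordAlgebra.contractLeft _
        (ExteriorAlgebra.map f (ExteriorAlgebra.ι ℂ x * t))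
    rw [contractLeft_ι_mul_exterior, map_sub, map_smul, map_mul, map_mul, ht,
      ExteriorAlgebra.map_apply_ι, contractLeft_ι_mul_exterior]
    rfl

theorem symDeriv_add {U : Type*} [AddCommGroup U] [Module ℂ U] (ξ ξ' : Module.Dual ℂ U) :
    symDeriv (ξ + ξ') = symDeriv ξ + symDeriv ξ' := by
  ext s
  induction s using SymmetricAlgebra.induction with
  | algebraMap r => simp
  | ι x => simp [symDeriv_ι]
  | mul a b ha hb => rw [Derivation.leibniz, Derivation.leibniz, ha, hb]
  | add a b ha hb => rw [map_add, map_add, ha, hb]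

theorem symDeriv_smul {U : Type*} [AddCommGroup U] [Module ℂ U] (c : ℂ) (ξ : Module.Dual ℂ U) :
    symDeriv (c • ξ) = c • symDeriv ξ := by
  ext s
  induction s using SymmetricAlgebra.induction with
  | algebraMap r => simp
  | ι x => simp [symDeriv_ι, Algebra.smul_def]
  | mul a b ha hb => rw [Derivation.leibniz, Derivation.leibniz, ha, hb]
  | add a b ha hb => rw [map_add, map_add, ha, hb]

variable (V₀ V₁) in
/-- The even partial derivative, as a linear map in the covector. -/
noncomputable def derivEvenₗ : Module.Dual ℂ V₀ →ₗ[ℂ] Module.End ℂ (P V₀ V₁) where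
  toFun := derivEven
  map_add' ξ ξ' := end_ext fun s t => by
    simp [derivEven_toP_tmul, symDeriv_add, TensorProduct.add_tmul]
  map_smul' c ξ := end_ext fun s t => by
    simp [derivEven_toP_tmul, symDeriv_smul, ← TensorProduct.smul_tmul']

variable (V₀ V₁) in
/-- The odd partial derivative, as a linear map in the covector. -/
noncomputable def derivOddₗ : Module.Dual ℂ V₁ →ₗ[ℂ] Module.End ℂ (P V₀ V₁) where
  toFun := derivOdd
  map_add' η η' := end_ext fun s t => by
    simp [derivOdd_toP_tmul, TensorProduct.tmul_add]
  map_smul' c η := end_ext fun s t => by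
    simp [derivOdd_toP_tmul]

variable {G : Type w} [Group G] (ρ₀ : Representation ℂ G V₀) (ρ₁ : Representation ℂ G V₁)

@[simp]
theorem repP_toP_tmul (g : G) (s : SymmetricAlgebra ℂ V₀) (t : ExteriorAlgebra ℂ V₁) :
    repP ρ₀ ρ₁ g (toP V₀ V₁ (s ⊗ₜ t)) =
      toP V₀ V₁ (symMap (ρ₀ g) s ⊗ₜ ExteriorAlgebra.map (ρ₁ g) t) :=
  mapP_toP_tmul _ _ s t

theorem repP_vacuum (g : G) : repP ρ₀ ρ₁ g (vacuum V₀ V₁) = vacuum V₀ V₁ := by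
  simp [vacuum]

/-- The conjugation action of `G` on the endomorphisms of `P(V)`. -/
noncomputable abbrev conjRep : Representation ℂ G (Module.End ℂ (P V₀ V₁)) :=
  (repP ρ₀ ρ₁).linHom (repP ρ₀ ρ₁)

theorem conjRep_apply_apply (g : G) (r : Module.End ℂ (P V₀ V₁)) (p : P V₀ V₁) :
    conjRep ρ₀ ρ₁ g r p = repP ρ₀ ρ₁ g (r (repP ρ₀ ρ₁ g⁻¹ p)) := rfl

theorem repP_apply_apply (g : G) (r : Module.End ℂ (P V₀ V₁)) (p : P V₀ V₁) :
    repP ρ₀ ρ₁ g (r p) = conjRep ρ₀ ρ₁ g r (repP ρ₀ ρ₁ g p) := by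
  rw [conjRep_apply_apply, Representation.inv_self_apply]

theorem conjRep_mul (g : G) (r r' : Module.End ℂ (P V₀ V₁)) :
    conjRep ρ₀ ρ₁ g (r * r') = conjRep ρ₀ ρ₁ g r * conjRep ρ₀ ρ₁ g r' := by
  ext p
  rw [Module.End.mul_apply, conjRep_apply_apply, Module.End.mul_apply, conjRep_apply_apply,
    conjRep_apply_apply, Representation.inv_self_apply]

theorem conjRep_algebraMap (g : G) (c : ℂ) :
    conjRep ρ₀ ρ₁ g (algebraMap ℂ _ c) = algebraMap ℂ _ c := by
  ext p
  rw [conjRep_apply_apply, Module.algebraMap_end_apply, map_smul, Representation.self_inv_apply,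
    Module.algebraMap_end_apply]

theorem conjRep_eq_of_comm {g : G} {r r' : Module.End ℂ (P V₀ V₁)}
    (h : ∀ s t, repP ρ₀ ρ₁ g (r (toP V₀ V₁ (s ⊗ₜ t))) =
      r' (repP ρ₀ ρ₁ g (toP V₀ V₁ (s ⊗ₜ t)))) : conjRep ρ₀ ρ₁ g r = r' := by
  have h1 : repP ρ₀ ρ₁ g * r = r' * repP ρ₀ ρ₁ g := end_ext h
  ext p
  have := LinearMap.congr_fun h1 (repP ρ₀ ρ₁ g⁻¹ p)
  rw [Module.End.mul_apply, Module.End.mul_apply, Representation.self_inv_apply] at this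
  exact this

theorem conjRep_mulEven (g : G) (x : V₀) :
    conjRep ρ₀ ρ₁ g (mulEven x) = mulEven (ρ₀ g x) :=
  conjRep_eq_of_comm ρ₀ ρ₁ fun s t => by simp [mulEven_toP_tmul, symMap_ι]

theorem conjRep_mulOdd (g : G) (y : V₁) : conjRep ρ₀ ρ₁ g (mulOdd y) = mulOdd (ρ₁ g y) :=
  conjRep_eq_of_comm ρ₀ ρ₁ fun s t => by simp [mulOdd_toP_tmul]

theorem dual_comp_self {U : Type*} [AddCommGroup U] [Module ℂ U] (ρ : Representation ℂ G U)
    (g : G) (ξ : Module.Dual ℂ U) : ρ.dual g ξ ∘ₗ ρ g = ξ := by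
  ext x
  simp [Representation.dual_apply, Module.Dual.transpose_apply]

theorem conjRep_derivEven (g : G) (ξ : Module.Dual ℂ V₀) :
    conjRep ρ₀ ρ₁ g (derivEven ξ) = derivEven (ρ₀.dual g ξ) :=
  conjRep_eq_of_comm ρ₀ ρ₁ fun s t => by
    rw [derivEven_toP_tmul, repP_toP_tmul, repP_toP_tmul, derivEven_toP_tmul, ← symMap_symDeriv,
      dual_comp_self]

theorem conjRep_derivOdd (g : G) (η : Module.Dual ℂ V₁) :
    conjRep ρ₀ ρ₁ g (derivOdd η) = derivOdd (ρ₁.dual g η) :=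
  conjRep_eq_of_comm ρ₀ ρ₁ fun s t => by
    rw [derivOdd_toP_tmul, repP_toP_tmul, repP_toP_tmul, derivOdd_toP_tmul, ← map_contractLeft,
      dual_comp_self]

theorem conjRep_mem_PD (g : G) {r : Module.End ℂ (P V₀ V₁)} (hr : r ∈ PD V₀ V₁) :
    conjRep ρ₀ ρ₁ g r ∈ PD V₀ V₁ := by
  induction hr using Algebra.adjoin_induction with
  | mem r hr =>
    rcases hr with ((⟨x, rfl⟩ | ⟨y, rfl⟩) | ⟨ξ, rfl⟩) | ⟨η, rfl⟩
    · rw [conjRep_mulEven]; exact mulEven_mem_PD _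
    · rw [conjRep_mulOdd]; exact mulOdd_mem_PD _
    · rw [conjRep_derivEven]; exact IsPartialDerivative.mem_PD (.inl ⟨_, rfl⟩)
    · rw [conjRep_derivOdd]; exact IsPartialDerivative.mem_PD (.inr ⟨_, rfl⟩)
  | algebraMap c => rw [conjRep_algebraMap]; exact (PD V₀ V₁).algebraMap_mem c
  | add r r' _ _ h h' => rw [map_add]; exact add_mem h h'
  | mul r r' _ _ h h' => rw [conjRep_mul]; exact mul_mem h h'

theorem mem_PDInv_of_conjRep_eq {r : Module.End ℂ (P V₀ V₁)} (hr : r ∈ PD V₀ V₁)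
    (h : ∀ g, conjRep ρ₀ ρ₁ g r = r) : r ∈ PDInv ρ₀ ρ₁ := by
  refine ⟨hr, (Subalgebra.mem_centralizer_iff ℂ).2 ?_⟩
  rintro _ ⟨g, rfl⟩
  ext p
  rw [Module.End.mul_apply, repP_apply_apply, h, Module.End.mul_apply]

theorem PDInv_apply_repP (T : PDInv ρ₀ ρ₁) (g : G) (p : P V₀ V₁) :
    (T : Module.End ℂ (P V₀ V₁)) (repP ρ₀ ρ₁ g p) =
      repP ρ₀ ρ₁ g ((T : Module.End ℂ (P V₀ V₁)) p) :=
  (LinearMap.congr_fun ((Subalgebra.mem_centralizer_iff ℂ).1 T.2.2 _ ⟨g, rfl⟩) p).symm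

theorem exists_mem_PD_vacuum_eq (p : P V₀ V₁) : ∃ r ∈ PD V₀ V₁, r (vacuum V₀ V₁) = p := by
  have h := PD_submodule_eq_top (Submodule.span (PD V₀ V₁) {vacuum V₀ V₁})
    (Submodule.mem_span_singleton_self _)
  obtain ⟨r, hr⟩ := Submodule.mem_span_singleton.1 (h ▸ Submodule.mem_top :
    p ∈ Submodule.span (PD V₀ V₁) {vacuum V₀ V₁})
  exact ⟨r, r.2, hr⟩

end Equivariance

/-! ### Regularity of the actions, and lifting equivariant maps to invariant operators. -/

section Regularity

variable {n : ℕ} {G : Subgroup (GL (Fin n) ℂ)}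

theorem IsRegularRep.dual {U : Type*} [AddCommGroup U] [Module ℂ U] [FiniteDimensional ℂ U]
    {ρ : Representation ℂ G U} (h : IsRegularRep G ρ) : IsRegularRep G ρ.dual := by
  intro φ ξ
  obtain ⟨x, rfl⟩ := (Module.evalEquiv ℂ U).surjective φ
  exact comp_inv_mem_regularFunctions (h ξ x)

variable {V₀ : Type u} {V₁ : Type v} [AddCommGroup V₀] [Module ℂ V₀] [FiniteDimensional ℂ V₀]
  [AddCommGroup V₁] [Module ℂ V₁] [FiniteDimensional ℂ V₁]
  {ρ₀ : Representation ℂ G V₀} {ρ₁ : Representation ℂ G V₁}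

/-- Conjugation moves each generator linearly through `V₀`, `V₁` or their duals, and regular maps
into an algebra are closed under sums and products. -/
theorem conjRep_orbit_mem_regularMaps (hρ₀ : IsRegularRep G ρ₀) (hρ₁ : IsRegularRep G ρ₁)
    {r : Module.End ℂ (P V₀ V₁)} (hr : r ∈ PD V₀ V₁) :
    (fun g => conjRep ρ₀ ρ₁ g r) ∈ regularMaps G (Module.End ℂ (P V₀ V₁)) := by
  induction hr using Algebra.adjoin_induction with
  | mem r hr =>
    rcases hr with ((⟨x, rfl⟩ | ⟨y, rfl⟩) | ⟨ξ, rfl⟩) | ⟨η, rfl⟩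
    · simp_rw [conjRep_mulEven]
      exact map_mem_regularMaps (mulEvenₗ V₀ V₁) (hρ₀.orbit_mem_regularMaps x)
    · simp_rw [conjRep_mulOdd]
      exact map_mem_regularMaps (mulOddₗ V₀ V₁) (hρ₁.orbit_mem_regularMaps y)
    · simp_rw [conjRep_derivEven]
      exact map_mem_regularMaps (derivEvenₗ V₀ V₁) (hρ₀.dual.orbit_mem_regularMaps ξ)
    · simp_rw [conjRep_derivOdd]
      exact map_mem_regularMaps (derivOddₗ V₀ V₁) (hρ₁.dual.orbit_mem_regularMaps η)
  | algebraMap c => simp_rw [conjRep_algebraMap]; exact const_mem_regularMaps _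
  | add r r' _ _ h h' => simp_rw [map_add]; exact add_mem h h'
  | mul r r' _ _ h h' => simp_rw [conjRep_mul]; exact mul_mem_regularMaps h h'

/-- Every `p` is `r · 1` with `r ∈ PD(V)`, and `G` fixes `1`, so `g p = (g r g⁻¹) · 1`: regularity
is inherited from the conjugation action. -/
theorem repP_orbit_mem_regularMaps (hρ₀ : IsRegularRep G ρ₀) (hρ₁ : IsRegularRep G ρ₁)
    (p : P V₀ V₁) : (fun g => repP ρ₀ ρ₁ g p) ∈ regularMaps G (P V₀ V₁) := by
  obtain ⟨r, hr, rfl⟩ := exists_mem_PD_vacuum_eq p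
  simp_rw [repP_apply_apply, repP_vacuum]
  exact map_mem_regularMaps (LinearMap.applyₗ (vacuum V₀ V₁))
    (conjRep_orbit_mem_regularMaps hρ₀ hρ₁ hr)

/-- Equivariant maps from finite-dimensional invariant subspaces of `P(V)` to `P(V)` are given by
invariant differential operators. -/
theorem exists_mem_PDInv_apply_eq (hG : IsReductiveGroup G) (hρ₀ : IsRegularRep G ρ₀)
    (hρ₁ : IsRegularRep G ρ₁) (X : Submodule ℂ (P V₀ V₁)) [FiniteDimensional ℂ X]
    (hX : ∀ g, ∀ x ∈ X, repP ρ₀ ρ₁ g x ∈ X) (T : X →ₗ[ℂ] P V₀ V₁)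
    (hT : ∀ g (x : X), T ⟨repP ρ₀ ρ₁ g x, hX g x x.2⟩ = repP ρ₀ ρ₁ g (T x)) :
    ∃ r ∈ PDInv ρ₀ ρ₁, ∀ x : X, r x = T x := by
  obtain ⟨r, hr, hrT⟩ := exists_mem_PD_apply_eq X T
  -- `K` consists of the operators vanishing on `X`. Equivariance of `T` says exactly that `r` is
  -- invariant modulo `K`. The invariant lift `y` stays in the span of the orbit of `r`, hence in
  -- `PD(V)`.
  let K : Submodule ℂ (Module.End ℂ (P V₀ V₁)) := LinearMap.ker (LinearMap.lcomp ℂ _ X.subtype)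
  have hK : ∀ y, y ∈ K ↔ ∀ x ∈ X, y x = 0 := fun y => by
    simp [K, LinearMap.ext_iff]
  obtain ⟨y, hy, hyr, hyG⟩ := exists_invariant_sub_mem hG
    (conjRep_orbit_mem_regularMaps hρ₀ hρ₁ hr) K
    (fun g y hy => (hK _).2 fun x hx => by
      rw [conjRep_apply_apply, (hK y).1 hy _ (hX g⁻¹ x hx), map_zero])
    (fun g => (hK _).2 fun x hx => by
      rw [LinearMap.sub_apply, conjRep_apply_apply, hrT ⟨_, hX g⁻¹ x hx⟩, hrT ⟨x, hx⟩,
        hT g⁻¹ ⟨x, hx⟩, Representation.self_inv_apply, sub_self])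
  have hyPD : y ∈ PD V₀ V₁ := by
    refine (Submodule.span_le (p := Subalgebra.toSubmodule (PD V₀ V₁))).2 ?_ hy
    rintro _ ⟨g, rfl⟩
    exact conjRep_mem_PD ρ₀ ρ₁ g hr
  refine ⟨y, mem_PDInv_of_conjRep_eq ρ₀ ρ₁ hyPD hyG, fun x => ?_⟩
  rw [← hrT x]
  exact sub_eq_zero.1 ((hK _).1 hyr x x.2)

end Regularity

/-! ### The commuting actions of `G` and `PD(V)^G`. -/

section Joint

open GroupAlgebraModule MultiplicitySpace

variable {V₀ : Type u} {V₁ : Type v} [AddCommGroup V₀] [Module ℂ V₀] [AddCommGroup V₁]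
  [Module ℂ V₁] {G : Type w} [Group G] {ρ₀ : Representation ℂ G V₀} {ρ₁ : Representation ℂ G V₁}

noncomputable instance : Module (PDInv ρ₀ ρ₁) (GroupAlgebraModule (repP ρ₀ ρ₁)) :=
  inferInstanceAs (Module (PDInv ρ₀ ρ₁) (P V₀ V₁))

instance : IsScalarTower ℂ (PDInv ρ₀ ρ₁) (GroupAlgebraModule (repP ρ₀ ρ₁)) :=
  inferInstanceAs (IsScalarTower ℂ (PDInv ρ₀ ρ₁) (P V₀ V₁))

theorem PDInv_smul_equiv (T : PDInv ρ₀ ρ₁) (p : P V₀ V₁) :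
    T • equiv (repP ρ₀ ρ₁) p = equiv _ ((T : Module.End ℂ (P V₀ V₁)) p) := rfl

instance : SMulCommClass ℂ[G] (PDInv ρ₀ ρ₁) (GroupAlgebraModule (repP ρ₀ ρ₁)) where
  smul_comm a T x := by
    obtain ⟨p, rfl⟩ := (equiv (repP ρ₀ ρ₁)).surjective x
    induction a using MonoidAlgebra.induction_linear with
    | zero => rw [zero_smul, zero_smul, smul_zero]
    | add a b ha hb => rw [add_smul, add_smul, smul_add, ha, hb]
    | single g c =>
      rw [PDInv_smul_equiv, smul_equiv, smul_equiv, PDInv_smul_equiv,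
        Representation.asAlgebraHom_single, LinearMap.smul_apply, LinearMap.smul_apply, map_smul,
        map_smul, PDInv_apply_repP, map_smul]

/-- The decomposition of `P(V)` is compatible with the joint action of `G` and `PD(V)^G`. -/
theorem decomposition_repP_apply
    [IsSemisimpleModule ℂ[G] (GroupAlgebraModule (repP ρ₀ ρ₁))]
    (hfin : ∀ c, FiniteDimensional ℂ
      (simpleType ℂ[G] (GroupAlgebraModule (repP ρ₀ ρ₁)) c))
    (g : G) (T : PDInv ρ₀ ρ₁) (p : P V₀ V₁) :
    decomposition ℂ ℂ[G] _ hfin (equiv (repP ρ₀ ρ₁)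
        (repP ρ₀ ρ₁ g ((T : Module.End ℂ (P V₀ V₁)) p))) =
      DirectSum.lmap (fun c => TensorProduct.map
        (Representation.ofModule' (k := ℂ) (G := G) (simpleType ℂ[G] _ c) g)
        (Algebra.lsmul ℂ ℂ (simpleType ℂ[G] _ c →ₗ[ℂ[G]] GroupAlgebraModule (repP ρ₀ ρ₁)) T))
        (decomposition ℂ ℂ[G] _ hfin (equiv (repP ρ₀ ρ₁) p)) := by
  have h : equiv (repP ρ₀ ρ₁) (repP ρ₀ ρ₁ g ((T : Module.End ℂ (P V₀ V₁)) p)) =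
      MonoidAlgebra.single g (1 : ℂ) • T • equiv (repP ρ₀ ρ₁) p :=
    (single_smul_equiv (repP ρ₀ ρ₁) g _).symm
  exact (congrArg (decomposition ℂ ℂ[G] _ hfin) h).trans
    (decomposition_smul_smul hfin (MonoidAlgebra.single g (1 : ℂ)) T (equiv _ p))

end Joint

/-! ### Density of the invariant operators, and the duality theorem. -/

section Duality

open GroupAlgebraModule MultiplicitySpace

variable {n : ℕ} {G : Subgroup (GL (Fin n) ℂ)}
  {V₀ : Type u} {V₁ : Type v} [AddCommGroup V₀] [Module ℂ V₀] [FiniteDimensional ℂ V₀]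
  [AddCommGroup V₁] [Module ℂ V₁] [FiniteDimensional ℂ V₁]
  {ρ₀ : Representation ℂ G V₀} {ρ₁ : Representation ℂ G V₁}

theorem isDense_PDInv (hG : IsReductiveGroup G) (hρ₀ : IsRegularRep G ρ₀)
    (hρ₁ : IsRegularRep G ρ₁) :
    IsDense ℂ ℂ[G] (PDInv ρ₀ ρ₁) (GroupAlgebraModule (repP ρ₀ ρ₁)) := by
  intro X hXfin T
  let X' : Submodule ℂ (P V₀ V₁) := (X.restrictScalars ℂ).comap (equiv (repP ρ₀ ρ₁)).toLinearMap
  have hX' : FiniteDimensional ℂ X' := hXfin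
  have hstable : ∀ g, ∀ x ∈ X', repP ρ₀ ρ₁ g x ∈ X' := fun g x hx => by
    change equiv _ (repP ρ₀ ρ₁ g x) ∈ X
    rw [← single_smul_equiv]
    exact X.smul_mem _ hx
  let T' : X' →ₗ[ℂ] P V₀ V₁ :=
    { toFun := fun x => (equiv (repP ρ₀ ρ₁)).symm (T ⟨equiv _ (x : P V₀ V₁), x.2⟩)
      map_add' := fun x y => by rw [← map_add, ← map_add]; rfl
      map_smul' := fun c x => by
        rw [RingHom.id_apply, ← map_smul, ← LinearMap.map_smul_of_tower]; rfl }
  obtain ⟨r, hr, h⟩ := exists_mem_PDInv_apply_eq hG hρ₀ hρ₁ X' hstable T' fun g x => by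
    have h1 := T.map_smul (MonoidAlgebra.single g (1 : ℂ)) ⟨equiv _ (x : P V₀ V₁), x.2⟩
    apply (equiv (repP ρ₀ ρ₁)).injective
    rw [← single_smul_equiv]
    refine Eq.trans ?_ h1
    change T _ = T _
    congr 1
    ext1
    exact (single_smul_equiv _ g (x : P V₀ V₁)).symm
  exact ⟨⟨r, hr⟩, fun x => h ⟨(equiv _).symm (x : GroupAlgebraModule (repP ρ₀ ρ₁)), x.2⟩⟩

end Duality

end SuperDuality

theorem theorem3p3 {n : ℕ} (G : Subgroup (GL (Fin n) ℂ)) (hG : SuperDuality.IsReductiveGroup G)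
    {V₀ : Type u} {V₁ : Type v} [AddCommGroup V₀] [Module ℂ V₀] [FiniteDimensional ℂ V₀]
    [AddCommGroup V₁] [Module ℂ V₁] [FiniteDimensional ℂ V₁]
    (ρ₀ : Representation ℂ G V₀) (hρ₀ : SuperDuality.IsRegularRep G ρ₀)
    (ρ₁ : Representation ℂ G V₁) (hρ₁ : SuperDuality.IsRegularRep G ρ₁) :
    ∃ (Ξ : Type (max u v))
      -- the `G`-modules `V(λ)`
      (L : Ξ → Type (max u v)) (_ : ∀ l, AddCommGroup (L l)) (_ : ∀ l, Module ℂ (L l))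
      (σ : ∀ l, Representation ℂ G (L l))
      -- the `PD(V)^G`-modules `V^λ`
      (M : Ξ → Type (max u v)) (_ : ∀ l, AddCommGroup (M l)) (_ : ∀ l, Module ℂ (M l))
      (_ : ∀ l, Module (SuperDuality.PDInv ρ₀ ρ₁) (M l))
      (_ : ∀ l, IsScalarTower ℂ (SuperDuality.PDInv ρ₀ ρ₁) (M l))
      (e : SuperDuality.P V₀ V₁ ≃ₗ[ℂ] ⨁ l, (L l ⊗[ℂ] M l)),
      -- the `V(λ)` are pairwise non-isomorphic irreducible regular representations of `G`
      (∀ l, FiniteDimensional ℂ (L l) ∧ SuperDuality.IsRegularRep G (σ l) ∧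
        (σ l).IsIrreducible) ∧
      (∀ l m, l ≠ m → IsEmpty ((σ l).Equiv (σ m))) ∧
      -- the `V^λ` are pairwise non-isomorphic irreducible `PD(V)^G`-modules
      (∀ l, IsSimpleModule (SuperDuality.PDInv ρ₀ ρ₁) (M l)) ∧
      (∀ l m, l ≠ m → IsEmpty (M l ≃ₗ[SuperDuality.PDInv ρ₀ ρ₁] M m)) ∧
      -- `e` is an isomorphism of joint `ℂ[G] ⊗ PD(V)^G`-modules
      (∀ (g : G) (T : SuperDuality.PDInv ρ₀ ρ₁) (p : SuperDuality.P V₀ V₁),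
        e (SuperDuality.repP ρ₀ ρ₁ g ((T : Module.End ℂ (SuperDuality.P V₀ V₁)) p)) =
          DirectSum.lmap
            (fun l => TensorProduct.map (σ l g) (Algebra.lsmul ℂ ℂ (M l) T)) (e p)) := by
  have hreg := SuperDuality.repP_orbit_mem_regularMaps hρ₀ hρ₁
  have := SuperDuality.isSemisimpleModule_groupAlgebraModule hG hreg
  have hfin : ∀ c, FiniteDimensional ℂ (MultiplicitySpace.simpleType (MonoidAlgebra ℂ G)
      (SuperDuality.GroupAlgebraModule (SuperDuality.repP ρ₀ ρ₁)) c) := fun c =>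
    SuperDuality.finiteDimensional_of_isSimpleModule hreg _
  have hd := SuperDuality.isDense_PDInv hG hρ₀ hρ₁
  -- The index set is the set of isotypic components; `V(λ)` is a chosen simple submodule of the
  -- component and `V^λ` is its multiplicity space.
  refine ⟨isotypicComponents (MonoidAlgebra ℂ G)
      (SuperDuality.GroupAlgebraModule (SuperDuality.repP ρ₀ ρ₁)),
    fun c => MultiplicitySpace.simpleType _ _ c, inferInstance, inferInstance,
    fun c => Representation.ofModule' _,
    fun c => MultiplicitySpace.simpleType _ _ c →ₗ[MonoidAlgebra ℂ G]
      SuperDuality.GroupAlgebraModule (SuperDuality.repP ρ₀ ρ₁),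
    inferInstance, inferInstance, inferInstance, inferInstance,
    (SuperDuality.GroupAlgebraModule.equiv _).trans
      (MultiplicitySpace.decomposition ℂ (MonoidAlgebra ℂ G) _ hfin),
    fun c => ⟨hfin c, SuperDuality.isRegularRep_ofModule' _ fun x _ => hreg x,
      SuperDuality.isIrreducible_ofModule'⟩,
    fun c d hcd => ⟨fun φ =>
      hcd (MultiplicitySpace.eq_of_linearEquiv (SuperDuality.linearEquivOfEquiv φ))⟩,
    fun c => hd.isSimpleModule_hom _, fun c d hcd => hd.isEmpty_linearEquiv_hom hcd,
    SuperDuality.decomposition_repP_apply hfin⟩
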